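/- Let $k\ge 0$. A $k$-graph is a countable category $C$ (identified with its set of arrows; $\mathbf d(a)$ and $\mathbf r(a)$ are the domain and codomain of $a$, and $ab$ is defined when $\mathbf d(a)=\mathbf r(b)$) together with a functor $d\colon C\to\mathbb N^k$ such that, whenever $d(a)=\mathbf m+\mathbf n$, there are unique $a_1,a_2\in C$ with $a=a_1a_2$, $d(a_1)=\mathbf m$, $d(a_2)=\mathbf n$. It is row finite if for every identity $e$ and every $\mathbf m\in\mathbb N^k$ only finitely many $a\in C$ satisfy $\mathbf r(a)=e$ and $d(a)=\mathbf m$, and it has no sources if there is always at least one such $a$. Arrows $a,b$ are comparable if $aC\cap bC\neq\varnothing$. *Path groupoid.* A $k$-tiling $w$ assigns to each pair $\mathbf m\le\mathbf n$ in $\mathbb N^k$ an arrow $w(\mathbf m,\mathbf n)$ of degree $\mathbf n-\mathbf m$ such that $w(\mathbf m,\mathbf m)$ is an identity and $w(\mathbf m,\mathbf n)w(\mathbf n,\mathbf p)=w(\mathbf m,\mathbf p)$. Put $\sigma^{\mathbf p}(w)(\mathbf m,\mathbf n)=w(\mathbf p+\mathbf m,\mathbf p+\mathbf n)$. The groupoid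 $\mathcal G(C)$ consists of the triples $(w_1,\mathbf n,w_2)$, where $w_1,w_2$ are $k$-tilings and $\mathbf n=\mathbf l-\mathbf m\in\mathbb Z^k$ for some $\mathbf l,\mathbf m\in\mathbb N^k$ with $\sigma^{\mathbf l}(w_1)=\sigma^{\mathbf m}(w_2)$. Its product is $(w_1,\mathbf m,w_2)(w_2,\mathbf n,w_3)=(w_1,\mathbf m+\mathbf n,w_3)$ and its inverse is $(w_1,\mathbf n,w_2)^{-1}=(w_2,-\mathbf n,w_1)$. A basis of its topology consists of the sets $Z(x,y)=\{(xw,d(x)-d(y),yw): w\text{ a }k\text{-tiling},\ w(\mathbf 0,\mathbf 0)=\mathbf d(x)\}$ for $\mathbf d(x)=\mathbf d(y)$, where $xw$ is the $k$-tiling $v$ with $v(\mathbf 0,d(x))=x$ and $\sigma^{d(x)}(v)=w$. *Allowable triples.* A set $A\subseteq C$ is good if its elements are pairwise comparable and it contains an element of each degree in $\mathbb N^k$; it is expanding if its elements are pairwise comparable and for each $\mathbf m\in\mathbb N^k$ it contains an element of degree $\ge\mathbf m$. Write $x^{-1}A=\{a: xa\in A\}$, and let $\mathsf{Pref}(A)$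 be the set of all $x$ such that $xu\in A$ for some $u$. A triple $(A,\mathbf n,B)$ with $A,B$ good and $\mathbf n\in\mathbb Z^k$ is allowable if there are $x\in A$, $y\in B$ with $\mathbf d(x)=\mathbf d(y)$, $\mathbf n=d(x)-d(y)$ and $x^{-1}A=y^{-1}B$. The product is $(A,\mathbf m,B)(B,\mathbf n,D)=(A,\mathbf m+\mathbf n,D)$, and a basis of the topology consists of the sets $Z'(x,y)=\{(\mathsf{Pref}(xA),d(x)-d(y),\mathsf{Pref}(yA)): A\subseteq\mathbf d(x)C\text{ expanding}\}$ for $\mathbf d(x)=\mathbf d(y)$. *Ultrafilter groupoid.* Suppose that $C$ is row finite with finitely many identities. Let $\mathsf R(C)$ be the inverse monoid of all bijections $\theta$ between finitely generated right ideals of $C$ (including $\varnothing$) with $\theta(rs)=\theta(r)s$. On an inverse semigroup with zero, with natural partial order $a\le b\Leftrightarrow a=ba^{-1}a$, define $s\equiv t$ to mean that every nonzero $x\le s$ has a common nonzero lower bound with $t$, and every nonzero $y\le t$ has one with $s$. Put $\mathsf B(C)=\mathsf R(C)/{\equiv}$. For $\mathbf d(x)=\mathbf d(y)$ let $xy^{-1}\in\mathsf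 R(C)$ be the map $yC\to xC$, $ys\mapsto xs$. A filter is a nonempty upward closed set in which any two elements have a lower bound, and an ultrafilter is a filter that is maximal among those not containing $0$. The ultrafilters $\mathcal A$ of $\mathsf B(C)$ form a groupoid with $\mathbf d(\mathcal A)=(\mathcal A^{-1}\mathcal A)^\uparrow$, $\mathbf r(\mathcal A)=(\mathcal A\mathcal A^{-1})^\uparrow$, product $(\mathcal A\mathcal B)^\uparrow$ when $\mathbf d(\mathcal A)=\mathbf r(\mathcal B)$, inverse $\mathcal A^{-1}$, and identities the ultrafilters that contain an idempotent. A basis of its topology consists of the sets of all ultrafilters containing a given element of $\mathsf B(C)$. **Statement.** (1) Let $C$ be any $k$-graph. The allowable triples form a groupoid, and $(w_1,\mathbf n,w_2)\mapsto(\mathscr C_{w_1},\mathbf n,\mathscr C_{w_2})$, where $\mathscr C_w=\{w(\mathbf 0,\mathbf m):\mathbf m\in\mathbb N^k\}$, is an isomorphism of topological groupoids from $\mathcal G(C)$ onto it. (2) Let $C$ be a row-finite $k$-graph with finitely many identities and no sources. Then there is an isomorphism of topological groupoids (in particular a bijection) from the groupoid of allowable triples onto the groupoid of ultrafilters of $\mathsf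 B(C)$ under which, for all $x,y$ with $\mathbf d(x)=\mathbf d(y)$, the set $Z'(x,y)$ corresponds to the set of ultrafilters containing the class $[xy^{-1}]$. Consequently the groupoid of ultrafilters of $\mathsf B(C)$ is isomorphic, as a topological groupoid, to $\mathcal G(C)$. -/

import Mathlib

open CategoryTheory
open scoped Pointwise

/-- An inverse monoid with zero: a monoid with zero in which each element `a` has a unique
element `a⁻¹` such that `a = a a⁻¹ a` and `a⁻¹ = a⁻¹ a a⁻¹`. -/
class InverseMonoidWithZero (S : Type*) extends MonoidWithZero S, Inv S where
  mul_inv_mul (a : S) : a * a⁻¹ * a = a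
  inv_mul_inv (a : S) : a⁻¹ * a * a⁻¹ = a⁻¹
  eq_inv (a b : S) : a * b * a = a → b * a * b = b → b = a⁻¹

namespace InverseMonoidWithZero

section Basic

variable {S : Type*} [InverseMonoidWithZero S]

theorem inv_inv_self (a : S) : a⁻¹⁻¹ = a :=
  (eq_inv a⁻¹ a (inv_mul_inv a) (mul_inv_mul a)).symm

theorem inv_of_idem {e : S} (he : e * e = e) : e⁻¹ = e :=
  (eq_inv e e (by rw [he, he]) (by rw [he, he])).symm

theorem idem_mul_idem {e f : S} (he : e * e = e) (hf : f * f = f) :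
    (e * f) * (e * f) = e * f := by
  have h1 := mul_inv_mul (e * f)
  have h2 := inv_mul_inv (e * f)
  set x := (e * f)⁻¹ with hx
  have hy : f * x * e = x := by
    refine eq_inv (e * f) (f * x * e) ?_ ?_
    · calc e * f * (f * x * e) * (e * f) = e * (f * f) * x * (e * e) * f := by
            simp only [mul_assoc]
        _ = e * f * x * (e * f) := by rw [he, hf]; simp only [mul_assoc]
        _ = e * f := h1
    · calc f * x * e * (e * f) * (f * x * e) = f * (x * ((e * e) * (f * f)) * x) * e := by
            simp only [mul_assoc]
        _ = f * x * e := by rw [he, hf, h2]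
  have hxx : x * x = x := by
    calc x * x = (f * x * e) * (f * x * e) := by rw [hy]
      _ = f * (x * (e * f) * x) * e := by simp only [mul_assoc]
      _ = x := by rw [h2, hy]
  have : e * f = x := by
    rw [← inv_of_idem hxx, hx, inv_inv_self]
  rw [this, hxx]

theorem idem_comm {e f : S} (he : e * e = e) (hf : f * f = f) : e * f = f * e := by
  have h1 := idem_mul_idem he hf
  have h2 := idem_mul_idem hf he
  have h3 : f * e = (e * f)⁻¹ := by
    refine eq_inv (e * f) (f * e) ?_ ?_
    · calc e * f * (f * e) * (e * f) = e * (f * f) * (e * e) * f := by simp only [mul_assoc]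
        _ = (e * f) * (e * f) := by rw [he, hf]; simp only [mul_assoc]
        _ = _ := h1
    · calc f * e * (e * f) * (f * e) = f * (e * e) * (f * f) * e := by simp only [mul_assoc]
        _ = (f * e) * (f * e) := by rw [he, hf]; simp only [mul_assoc]
        _ = _ := h2
  rw [h3, inv_of_idem h1]

theorem inv_mul_idem (a : S) : (a⁻¹ * a) * (a⁻¹ * a) = a⁻¹ * a := by
  rw [← mul_assoc, inv_mul_inv]

theorem mul_inv_idem (a : S) : (a * a⁻¹) * (a * a⁻¹) = a * a⁻¹ := by
  rw [← mul_assoc, mul_inv_mul]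

theorem mul_inv_rev_self (a b : S) : (a * b)⁻¹ = b⁻¹ * a⁻¹ := by
  symm
  have hc := idem_comm (inv_mul_idem a) (mul_inv_idem b)
  refine eq_inv _ _ ?_ ?_
  · calc a * b * (b⁻¹ * a⁻¹) * (a * b) = a * ((b * b⁻¹) * (a⁻¹ * a)) * b := by
          simp only [mul_assoc]
      _ = (a * a⁻¹ * a) * (b * b⁻¹ * b) := by rw [← hc]; simp only [mul_assoc]
      _ = a * b := by rw [mul_inv_mul, mul_inv_mul]
  · calc b⁻¹ * a⁻¹ * (a * b) * (b⁻¹ * a⁻¹) = b⁻¹ * ((a⁻¹ * a) * (b * b⁻¹)) * a⁻¹ := by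
          simp only [mul_assoc]
      _ = (b⁻¹ * b * b⁻¹) * (a⁻¹ * a * a⁻¹) := by rw [hc]; simp only [mul_assoc]
      _ = _ := by rw [inv_mul_inv, inv_mul_inv]

theorem inv_zero_self : (0 : S)⁻¹ = 0 := inv_of_idem (mul_zero 0)

/-- `b e b⁻¹`-type rewriting: an idempotent can be moved past an element. -/
theorem idem_mul_eq {e : S} (he : e * e = e) (b : S) : e * b = b * (b⁻¹ * e * b) := by
  calc e * b = e * (b * b⁻¹ * b) := by rw [mul_inv_mul]
    _ = (e * (b * b⁻¹)) * b := by simp only [mul_assoc]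
    _ = ((b * b⁻¹) * e) * b := by rw [idem_comm he (mul_inv_idem b)]
    _ = _ := by simp only [mul_assoc]

theorem conj_idem {e : S} (he : e * e = e) (b : S) :
    (b⁻¹ * e * b) * (b⁻¹ * e * b) = b⁻¹ * e * b := by
  calc (b⁻¹ * e * b) * (b⁻¹ * e * b) = b⁻¹ * e * (b * (b⁻¹ * e * b)) := by simp only [mul_assoc]
    _ = b⁻¹ * (e * e) * b := by rw [← idem_mul_eq he]; simp only [mul_assoc]
    _ = _ := by rw [he]

theorem natural_of_idem {a b e : S} (he : e * e = e) (h : a = b * e) : a = b * a⁻¹ * a := by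
  subst h
  rw [mul_inv_rev_self, inv_of_idem he]
  calc b * e = b * b⁻¹ * b * (e * e) := by rw [mul_inv_mul, he]
    _ = b * ((b⁻¹ * b) * e) * e := by simp only [mul_assoc]
    _ = b * (e * (b⁻¹ * b)) * e := by rw [idem_comm he (inv_mul_idem b)]
    _ = _ := by simp only [mul_assoc]

/-- The natural partial order: `a ≤ b` if and only if `a = b a⁻¹ a`. -/
instance naturalOrder : PartialOrder S where
  le a b := a = b * a⁻¹ * a
  le_refl a := (mul_inv_mul a).symm
  le_trans a b c hab hbc := by
    have h : a = c * ((b⁻¹ * b) * (a⁻¹ * a)) := by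
      calc a = b * a⁻¹ * a := hab
        _ = (c * b⁻¹ * b) * a⁻¹ * a := by rw [← hbc]
        _ = _ := by simp only [mul_assoc]
    exact natural_of_idem (idem_mul_idem (inv_mul_idem b) (inv_mul_idem a)) h
  le_antisymm a b hab hba := by
    have h1 : a = b * (a⁻¹ * a) := by rw [← mul_assoc]; exact hab
    have h2 : b = a * (b⁻¹ * b) := by rw [← mul_assoc]; exact hba
    calc a = b * (a⁻¹ * a) := h1
      _ = a * ((b⁻¹ * b) * (a⁻¹ * a)) := by
          rw [← mul_assoc a, ← h2]
      _ = a * ((a⁻¹ * a) * (b⁻¹ * b)) := by rw [idem_comm (inv_mul_idem a) (inv_mul_idem b)]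
      _ = (a * a⁻¹ * a) * (b⁻¹ * b) := by simp only [mul_assoc]
      _ = b := by rw [mul_inv_mul, ← h2]

theorem le_def {a b : S} : a ≤ b ↔ a = b * a⁻¹ * a := Iff.rfl

theorem le_iff_idem {a b : S} : a ≤ b ↔ ∃ e : S, e * e = e ∧ a = b * e :=
  ⟨fun h => ⟨a⁻¹ * a, inv_mul_idem a, by rw [← mul_assoc]; exact h⟩,
    fun ⟨_, he, h⟩ => natural_of_idem he h⟩

theorem le_iff_idem_left {a b : S} : a ≤ b ↔ ∃ e : S, e * e = e ∧ a = e * b := by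
  constructor
  · intro h
    obtain ⟨e, he, rfl⟩ := le_iff_idem.1 h
    refine ⟨b * e * b⁻¹, ?_, ?_⟩
    · simpa [inv_inv_self] using conj_idem he b⁻¹
    · have := idem_comm he (inv_mul_idem b)
      calc b * e = b * b⁻¹ * b * e := by rw [mul_inv_mul]
        _ = b * ((b⁻¹ * b) * e) := by simp only [mul_assoc]
        _ = b * (e * (b⁻¹ * b)) := by rw [this]
        _ = _ := by simp only [mul_assoc]
  · rintro ⟨e, he, rfl⟩
    exact le_iff_idem.2 ⟨b⁻¹ * e * b, conj_idem he b, idem_mul_eq he b⟩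

theorem mul_le_mul_self {a b c d : S} (h : a ≤ b) (h' : c ≤ d) : a * c ≤ b * d := by
  obtain ⟨e, he, rfl⟩ := le_iff_idem.1 h
  obtain ⟨f, hf, rfl⟩ := le_iff_idem.1 h'
  refine le_iff_idem.2 ⟨(d⁻¹ * e * d) * f, idem_mul_idem (conj_idem he d) hf, ?_⟩
  calc b * e * (d * f) = b * (e * d) * f := by simp only [mul_assoc]
    _ = b * (d * (d⁻¹ * e * d)) * f := by rw [← idem_mul_eq he d]
    _ = _ := by simp only [mul_assoc]

theorem inv_le_inv_self {a b : S} (h : a ≤ b) : a⁻¹ ≤ b⁻¹ := by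
  obtain ⟨e, he, rfl⟩ := le_iff_idem.1 h
  exact le_iff_idem_left.2 ⟨e, he, by rw [mul_inv_rev_self, inv_of_idem he]⟩

theorem mul_idem_le {e : S} (he : e * e = e) (a : S) : a * e ≤ a := le_iff_idem.2 ⟨e, he, rfl⟩

theorem idem_mul_le {e : S} (he : e * e = e) (a : S) : e * a ≤ a :=
  le_iff_idem_left.2 ⟨e, he, rfl⟩

theorem eq_mul_of_le {a b : S} (h : a ≤ b) : a = b * (a⁻¹ * a) := by
  rw [← mul_assoc]; exact h

theorem eq_mul_of_le_left {a b : S} (h : a ≤ b) : a = a * a⁻¹ * b := by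
  have h1 := eq_mul_of_le (inv_le_inv_self h)
  rw [inv_inv_self] at h1
  have h2 := congrArg (fun x => x⁻¹) h1
  simpa only [mul_inv_rev_self, inv_inv_self] using h2

theorem idem_of_le_idem {a e : S} (he : e * e = e) (h : a ≤ e) : a * a = a := by
  obtain ⟨f, hf, rfl⟩ := le_iff_idem.1 h
  exact idem_mul_idem he hf

end Basic

section Lenz

variable (S : Type*) [InverseMonoidWithZero S]

theorem lenz_half_mul {s t u : S}
    (h : ∀ x : S, x ≠ 0 → x ≤ s → ∃ z : S, z ≠ 0 ∧ z ≤ x ∧ z ≤ t) :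
    ∀ x : S, x ≠ 0 → x ≤ s * u → ∃ z : S, z ≠ 0 ∧ z ≤ x ∧ z ≤ t * u := by
  intro x hx hxs
  have e1 : x * u⁻¹ * u = x := by
    have := eq_mul_of_le_left hxs
    calc x * u⁻¹ * u = x * x⁻¹ * (s * (u * u⁻¹ * u)) := by
          conv_lhs => rw [this]
          simp only [mul_assoc]
      _ = x := by rw [mul_inv_mul]; exact this.symm
  have hle : x * u⁻¹ ≤ s := by
    refine (mul_le_mul_self hxs (le_refl u⁻¹)).trans ?_
    rw [mul_assoc]
    exact mul_idem_le (mul_inv_idem u) s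
  obtain ⟨z, hz, hzx, hzt⟩ := h (x * u⁻¹) (fun h0 => hx (by rw [← e1, h0, zero_mul])) hle
  refine ⟨z * u, fun h0 => hz ?_, ?_, mul_le_mul_self hzt le_rfl⟩
  · have hz1 := eq_mul_of_le_left hzx
    calc z = z * z⁻¹ * (x * (u⁻¹ * u * u⁻¹)) := by rw [inv_mul_inv]; exact hz1
      _ = (z * z⁻¹ * (x * u⁻¹)) * u * u⁻¹ := by simp only [mul_assoc]
      _ = 0 := by rw [← hz1, h0, zero_mul]
  · have := mul_le_mul_self hzx (le_refl u)
    rwa [e1] at this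

theorem lenz_half_inv {s t : S}
    (h : ∀ x : S, x ≠ 0 → x ≤ s → ∃ z : S, z ≠ 0 ∧ z ≤ x ∧ z ≤ t) :
    ∀ x : S, x ≠ 0 → x ≤ s⁻¹ → ∃ z : S, z ≠ 0 ∧ z ≤ x ∧ z ≤ t⁻¹ := by
  intro x hx hxs
  obtain ⟨z, hz, hzx, hzt⟩ := h x⁻¹
    (fun h0 => hx (by rw [← inv_inv_self x, h0, inv_zero_self]))
    (by simpa [inv_inv_self] using inv_le_inv_self hxs)
  refine ⟨z⁻¹, fun h0 => hz (by rw [← inv_inv_self z, h0, inv_zero_self]), ?_,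
    inv_le_inv_self hzt⟩
  simpa [inv_inv_self] using inv_le_inv_self hzx

theorem lenz_half_mul_left {s t u : S}
    (h : ∀ x : S, x ≠ 0 → x ≤ s → ∃ z : S, z ≠ 0 ∧ z ≤ x ∧ z ≤ t) :
    ∀ x : S, x ≠ 0 → x ≤ u * s → ∃ z : S, z ≠ 0 ∧ z ≤ x ∧ z ≤ u * t := by
  have := lenz_half_inv S (lenz_half_mul S (u := u⁻¹) (lenz_half_inv S h))
  simpa only [mul_inv_rev_self, inv_inv_self] using this

/-- The Lenz congruence: `s ≡ t` if every nonzero `x ≤ s` and `t` have a common nonzero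
lower bound, and every nonzero `y ≤ t` and `s` have a common nonzero lower bound. -/
def lenz : Con S where
  r s t := (∀ x : S, x ≠ 0 → x ≤ s → ∃ z : S, z ≠ 0 ∧ z ≤ x ∧ z ≤ t) ∧
    (∀ y : S, y ≠ 0 → y ≤ t → ∃ z : S, z ≠ 0 ∧ z ≤ y ∧ z ≤ s)
  iseqv :=
    { refl := fun _ => ⟨fun x hx h => ⟨x, hx, le_rfl, h⟩, fun x hx h => ⟨x, hx, le_rfl, h⟩⟩
      symm := fun h => ⟨h.2, h.1⟩
      trans := fun {a b c} h h' => by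
        constructor
        · intro x hx hxa
          obtain ⟨z, hz, hzx, hzb⟩ := h.1 x hx hxa
          obtain ⟨y, hy, hyz, hyc⟩ := h'.1 z hz hzb
          exact ⟨y, hy, hyz.trans hzx, hyc⟩
        · intro x hx hxc
          obtain ⟨z, hz, hzx, hzb⟩ := h'.2 x hx hxc
          obtain ⟨y, hy, hyz, hya⟩ := h.2 z hz hzb
          exact ⟨y, hy, hyz.trans hzx, hya⟩ }
  mul' := by
    intro a b c d h h'
    constructor
    · intro x hx hxa
      obtain ⟨z, hz, hzx, hzb⟩ := lenz_half_mul S h.1 x hx hxa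
      obtain ⟨y, hy, hyz, hyc⟩ := lenz_half_mul_left S h'.1 z hz hzb
      exact ⟨y, hy, hyz.trans hzx, hyc⟩
    · intro x hx hxc
      obtain ⟨z, hz, hzx, hzb⟩ := lenz_half_mul S h.2 x hx hxc
      obtain ⟨y, hy, hyz, hya⟩ := lenz_half_mul_left S h'.2 z hz hzb
      exact ⟨y, hy, hyz.trans hzx, hya⟩

/-- The quotient of an inverse monoid with zero by its Lenz congruence. -/
abbrev LenzQuotient : Type _ := (lenz S).Quotient

variable {S}

/-- Idempotents of the quotient lift to idempotents. -/
theorem lenz_lift_idem (q : LenzQuotient S) (hq : q * q = q) :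
    ∃ e : S, e * e = e ∧ (e : LenzQuotient S) = q := by
  induction q using Con.induction_on with
  | H a =>
    have h1 := mul_inv_mul (a * a)
    have h2 := inv_mul_inv (a * a)
    refine ⟨a * (a * a)⁻¹ * a, ?_, ?_⟩
    · calc a * (a * a)⁻¹ * a * (a * (a * a)⁻¹ * a)
          = a * ((a * a)⁻¹ * (a * a) * (a * a)⁻¹) * a := by simp only [mul_assoc]
        _ = _ := by rw [h2]
    · have h3 : ((a * (a * a)⁻¹ * a : S) : LenzQuotient S)
          = (a : LenzQuotient S) * (((a * a)⁻¹ : S) : LenzQuotient S) * a := rfl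
      calc ((a * (a * a)⁻¹ * a : S) : LenzQuotient S)
          = ((a : LenzQuotient S) * a) * (((a * a)⁻¹ : S) : LenzQuotient S) * (a * a) := by
            rw [h3, hq]
        _ = (((a * a) * (a * a)⁻¹ * (a * a) : S) : LenzQuotient S) := rfl
        _ = ((a * a : S) : LenzQuotient S) := by rw [h1]
        _ = a := hq

theorem lenz_idem_comm (p q : LenzQuotient S) (hp : p * p = p) (hq : q * q = q) :
    p * q = q * p := by
  obtain ⟨e, he, rfl⟩ := lenz_lift_idem p hp
  obtain ⟨f, hf, rfl⟩ := lenz_lift_idem q hq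
  exact congrArg (fun x : S => (x : LenzQuotient S)) (idem_comm he hf)

instance : Inv (LenzQuotient S) where
  inv := Quotient.map' (fun a => a⁻¹)
    (fun _ _ h => ⟨lenz_half_inv S h.1, lenz_half_inv S h.2⟩)

instance : InverseMonoidWithZero (LenzQuotient S) where
  zero := ((0 : S) : LenzQuotient S)
  zero_mul q := by
    induction q using Con.induction_on with
    | H a => exact congrArg (fun x : S => (x : LenzQuotient S)) (zero_mul a)
  mul_zero q := by
    induction q using Con.induction_on with
    | H a => exact congrArg (fun x : S => (x : LenzQuotient S)) (mul_zero a)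
  mul_inv_mul q := by
    induction q using Con.induction_on with
    | H a => exact congrArg (fun x : S => (x : LenzQuotient S)) (mul_inv_mul a)
  inv_mul_inv q := by
    induction q using Con.induction_on with
    | H a => exact congrArg (fun x : S => (x : LenzQuotient S)) (inv_mul_inv a)
  eq_inv q b h1 h2 := by
    have h3 : q * q⁻¹ * q = q := by
      induction q using Con.induction_on with
      | H a => exact congrArg (fun x : S => (x : LenzQuotient S)) (mul_inv_mul a)
    have h4 : q⁻¹ * q * q⁻¹ = q⁻¹ := by
      induction q using Con.induction_on with
      | H a => exact congrArg (fun x : S => (x : LenzQuotient S)) (inv_mul_inv a)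
    have c1 : (b * q) * (q⁻¹ * q) = (q⁻¹ * q) * (b * q) :=
      lenz_idem_comm _ _ (by rw [← mul_assoc, h2]) (by rw [← mul_assoc, h4])
    have c2 : (q * b) * (q * q⁻¹) = (q * q⁻¹) * (q * b) :=
      lenz_idem_comm _ _ (by rw [← mul_assoc, h1]) (by rw [← mul_assoc, h3])
    calc b = b * q * b := h2.symm
      _ = b * (q * q⁻¹ * q) * b := by rw [h3]
      _ = ((b * q) * (q⁻¹ * q)) * b := by simp only [mul_assoc]
      _ = q⁻¹ * (q * b * q) * b := by rw [c1]; simp only [mul_assoc]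
      _ = q⁻¹ * q * b := by rw [h1]
      _ = q⁻¹ * (q * q⁻¹ * q) * b := by rw [h3]
      _ = q⁻¹ * ((q * q⁻¹) * (q * b)) := by simp only [mul_assoc]
      _ = q⁻¹ * (q * b * q) * q⁻¹ := by rw [← c2]; simp only [mul_assoc]
      _ = q⁻¹ := by rw [h1, h4]

end Lenz

end InverseMonoidWithZero

/-- A filter: a nonempty upper set in which any two elements have a lower bound.
It is proper if it does not contain `0`; an ultrafilter is a maximal proper filter. -/
def IsUltra {S : Type*} [InverseMonoidWithZero S] (A : Set S) : Prop :=
  Maximal (fun B : Set S => Order.IsPFilter B ∧ (0 : S) ∉ B) A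

namespace InverseMonoidWithZero

section Ultra

variable {S : Type*} [InverseMonoidWithZero S]

theorem filter_iff {A : Set S} : Order.IsPFilter A ↔
    A.Nonempty ∧ (∀ a ∈ A, ∀ b ∈ A, ∃ c ∈ A, c ≤ a ∧ c ≤ b) ∧ (∀ a b, a ≤ b → a ∈ A → b ∈ A) := by
  constructor
  · intro h
    exact ⟨h.toPFilter.nonempty, h.toPFilter.directed, fun a b hab ha =>
      h.toPFilter.mem_of_le hab ha⟩
  · rintro ⟨h1, h2, h3⟩
    exact Order.IsPFilter.of_def h1 h2 (fun hab ha => h3 _ _ hab ha)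

/-- The upward closure of a set in the natural partial order. -/
def up (A : Set S) : Set S := {b | ∃ a ∈ A, a ≤ b}

theorem subset_up (A : Set S) : A ⊆ up A := fun a ha => ⟨a, ha, le_rfl⟩

theorem up_mul_up_left (A B : Set S) : up (up A * B) = up (A * B) := by
  ext x
  constructor
  · rintro ⟨_, ⟨y, ⟨a, ha, hay⟩, b, hb, rfl⟩, h⟩
    exact ⟨a * b, ⟨a, ha, b, hb, rfl⟩, (mul_le_mul_self hay le_rfl).trans h⟩
  · rintro ⟨_, ⟨a, ha, b, hb, rfl⟩, h⟩
    exact ⟨a * b, ⟨a, subset_up A ha, b, hb, rfl⟩, h⟩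

theorem up_mul_up_right (A B : Set S) : up (A * up B) = up (A * B) := by
  ext x
  constructor
  · rintro ⟨_, ⟨a, ha, y, ⟨b, hb, hby⟩, rfl⟩, h⟩
    exact ⟨a * b, ⟨a, ha, b, hb, rfl⟩, (mul_le_mul_self le_rfl hby).trans h⟩
  · rintro ⟨_, ⟨a, ha, b, hb, rfl⟩, h⟩
    exact ⟨a * b, ⟨a, ha, b, subset_up B hb, rfl⟩, h⟩

theorem up_inv (A : Set S) : up A⁻¹ = (up A)⁻¹ := by
  ext x
  constructor
  · rintro ⟨a, ha, h⟩
    exact ⟨a⁻¹, ha, inv_le_inv_self h⟩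
  · rintro ⟨a, ha, h⟩
    refine ⟨a⁻¹, by simpa [inv_inv_self] using ha, ?_⟩
    simpa [inv_inv_self] using inv_le_inv_self h

theorem set_inv_inv (A : Set S) : A⁻¹⁻¹ = A := by
  ext x
  simp [Set.mem_inv, inv_inv_self]

theorem set_mul_inv (A B : Set S) : (A * B)⁻¹ = B⁻¹ * A⁻¹ := by
  ext x
  constructor
  · rintro ⟨a, ha, b, hb, h⟩
    refine ⟨b⁻¹, by simpa [inv_inv_self] using hb, a⁻¹, by simpa [inv_inv_self] using ha, ?_⟩
    change b⁻¹ * a⁻¹ = x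
    rw [← mul_inv_rev_self, ← inv_inv_self x]
    exact congrArg _ h
  · rintro ⟨b, hb, a, ha, rfl⟩
    refine ⟨a⁻¹, ha, b⁻¹, hb, ?_⟩
    exact (mul_inv_rev_self b a).symm

/-- The domain `(A⁻¹ A)↑` of a subset `A`. -/
def udom (A : Set S) : Set S := up (A⁻¹ * A)

/-- The range `(A A⁻¹)↑` of a subset `A`. -/
def uran (A : Set S) : Set S := up (A * A⁻¹)

theorem udom_inv (A : Set S) : udom A⁻¹ = uran A := by rw [udom, uran, set_inv_inv]

theorem uran_inv (A : Set S) : uran A⁻¹ = udom A := by rw [udom, uran, set_inv_inv]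

theorem mem_udom {A : Set S} (hA : Order.IsPFilter A) {x : S} :
    x ∈ udom A ↔ ∃ a ∈ A, a⁻¹ * a ≤ x := by
  obtain ⟨-, h2, -⟩ := filter_iff.1 hA
  constructor
  · rintro ⟨_, ⟨a, ha, b, hb, rfl⟩, h⟩
    obtain ⟨c, hc, hca, hcb⟩ := h2 _ ha _ hb
    refine ⟨c, hc, le_trans (mul_le_mul_self ?_ hcb) h⟩
    simpa [inv_inv_self] using inv_le_inv_self hca
  · rintro ⟨a, ha, h⟩
    exact ⟨_, ⟨a⁻¹, by simpa [inv_inv_self] using ha, a, ha, rfl⟩, h⟩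

theorem filter_inv {A : Set S} (hA : Order.IsPFilter A) : Order.IsPFilter A⁻¹ := by
  obtain ⟨⟨a, ha⟩, h2, h3⟩ := filter_iff.1 hA
  refine filter_iff.2 ⟨⟨a⁻¹, by simpa [inv_inv_self] using ha⟩, ?_, ?_⟩
  · intro a ha b hb
    obtain ⟨c, hc, hca, hcb⟩ := h2 _ ha _ hb
    refine ⟨c⁻¹, by simpa [inv_inv_self] using hc, ?_, ?_⟩
    · simpa [inv_inv_self] using inv_le_inv_self hca
    · simpa [inv_inv_self] using inv_le_inv_self hcb
  · intro a b hab ha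
    exact h3 _ _ (inv_le_inv_self hab) ha

theorem mem_uran {A : Set S} (hA : Order.IsPFilter A) {x : S} :
    x ∈ uran A ↔ ∃ a ∈ A, a * a⁻¹ ≤ x := by
  rw [← udom_inv, mem_udom (filter_inv hA)]
  constructor
  · rintro ⟨a, ha, h⟩
    exact ⟨a⁻¹, ha, by rwa [inv_inv_self]⟩
  · rintro ⟨a, ha, h⟩
    exact ⟨a⁻¹, by simpa [inv_inv_self] using ha, by rwa [inv_inv_self]⟩

theorem ultra_inv {A : Set S} (hA : IsUltra A) : IsUltra A⁻¹ := by
  refine ⟨⟨filter_inv hA.1.1, fun h => hA.1.2 ?_⟩, ?_⟩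
  · rw [Set.mem_inv, inv_zero_self] at h
    exact h
  · rintro B ⟨hB, hB0⟩ h x hx
    have : A ⊆ B⁻¹ := fun a ha => h (by simpa [inv_inv_self] using ha)
    have h2 := hA.2 ⟨filter_inv hB, fun h => hB0 (by
      rw [Set.mem_inv, inv_zero_self] at h
      exact h)⟩ this
    exact h2 (by simpa [inv_inv_self] using hx)

/-- If `A` is a proper filter with `s⁻¹ s` in its range then `(s A)↑` is a proper filter. -/
theorem translate_filter {A : Set S} (hA : Order.IsPFilter A ∧ (0 : S) ∉ A) {s : S}
    (hs : s⁻¹ * s ∈ uran A) :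
    Order.IsPFilter (up ((fun a => s * a) '' A)) ∧ (0 : S) ∉ up ((fun a => s * a) '' A) := by
  obtain ⟨⟨a, ha⟩, h2, h3⟩ := filter_iff.1 hA.1
  refine ⟨filter_iff.2 ⟨⟨s * a, subset_up _ ⟨a, ha, rfl⟩⟩, ?_, ?_⟩, ?_⟩
  · rintro x ⟨_, ⟨a, ha, rfl⟩, hx⟩ y ⟨_, ⟨b, hb, rfl⟩, hy⟩
    obtain ⟨c, hc, hca, hcb⟩ := h2 _ ha _ hb
    exact ⟨s * c, subset_up _ ⟨c, hc, rfl⟩, (mul_le_mul_self le_rfl hca).trans hx,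
      (mul_le_mul_self le_rfl hcb).trans hy⟩
  · rintro x y hxy ⟨z, hz, hzx⟩
    exact ⟨z, hz, hzx.trans hxy⟩
  · rintro ⟨_, ⟨a, ha, rfl⟩, h0⟩
    obtain ⟨b, hb, hbs⟩ := (mem_uran hA.1).1 hs
    obtain ⟨c, hc, hca, hcb⟩ := h2 _ ha _ hb
    have hsa : s * a = 0 := by
      rw [le_def] at h0
      simpa using h0
    have hc1 : c * c⁻¹ ≤ s⁻¹ * s :=
      (mul_le_mul_self hcb (inv_le_inv_self hcb)).trans hbs
    have hc2 : s⁻¹ * s * c = c := by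
      have := eq_mul_of_le hc1
      calc s⁻¹ * s * c = s⁻¹ * s * ((c * c⁻¹) * c) := by rw [mul_inv_mul]
        _ = s⁻¹ * s * ((s⁻¹ * s * ((c * c⁻¹)⁻¹ * (c * c⁻¹))) * c) := by rw [← this]
        _ = (s⁻¹ * s) * (s⁻¹ * s) * (((c * c⁻¹)⁻¹ * (c * c⁻¹)) * c) := by simp only [mul_assoc]
        _ = (s⁻¹ * s * ((c * c⁻¹)⁻¹ * (c * c⁻¹))) * c := by
            rw [inv_mul_idem]; simp only [mul_assoc]
        _ = c := by rw [← this, mul_inv_mul]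
    have hsc : s * c = 0 := by
      have h := mul_le_mul_self (le_refl s) hca
      rw [hsa, le_def] at h
      simpa using h
    apply hA.2
    rw [mul_assoc, hsc, mul_zero] at hc2
    rwa [hc2]

theorem translate_ultra {A : Set S} (hA : IsUltra A) {s : S} (hs : s⁻¹ * s ∈ uran A) :
    IsUltra (up ((fun a => s * a) '' A)) := by
  refine ⟨translate_filter hA.1 hs, ?_⟩
  intro X hX hAX x hx
  have hs' : s⁻¹⁻¹ * s⁻¹ ∈ uran X := by
    obtain ⟨⟨a, ha⟩, -, -⟩ := filter_iff.1 hA.1.1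
    refine (mem_uran hX.1).2 ⟨s * a, hAX (subset_up _ ⟨a, ha, rfl⟩), ?_⟩
    rw [inv_inv_self, mul_inv_rev_self]
    calc s * a * (a⁻¹ * s⁻¹) = s * ((a * a⁻¹) * s⁻¹) := by simp only [mul_assoc]
      _ ≤ s * s⁻¹ := mul_le_mul_self le_rfl (idem_mul_le (mul_inv_idem a) _)
  have hsub : A ⊆ up ((fun a => s⁻¹ * a) '' X) := by
    intro a ha
    refine ⟨s⁻¹ * (s * a), ⟨s * a, hAX (subset_up _ ⟨a, ha, rfl⟩), rfl⟩, ?_⟩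
    rw [← mul_assoc]
    exact idem_mul_le (inv_mul_idem s) a
  have h1 := hA.2 (translate_filter hX hs') hsub
  refine ⟨s * (s⁻¹ * x), ⟨s⁻¹ * x, h1 (subset_up _ ⟨x, hx, rfl⟩), rfl⟩, ?_⟩
  rw [← mul_assoc]
  exact idem_mul_le (mul_inv_idem s) x

/-- If `udom B = uran A` then `(B A)↑` is the translate of `A` by any element of `B`. -/
theorem up_mul_eq {A B : Set S} (hA : Order.IsPFilter A) (hB : Order.IsPFilter B)
    (h : udom B = uran A) {b : S} (hb : b ∈ B) :
    up (B * A) = up ((fun a => b * a) '' A) := by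
  obtain ⟨-, hA2, -⟩ := filter_iff.1 hA
  obtain ⟨-, hB2, -⟩ := filter_iff.1 hB
  ext x
  constructor
  · rintro ⟨_, ⟨b', hb', a', ha', rfl⟩, hx⟩
    obtain ⟨c, hc, hcb, hcb'⟩ := hB2 _ hb _ hb'
    have h1 : c⁻¹ * c ∈ uran A := h ▸ (mem_udom hB).2 ⟨c, hc, le_rfl⟩
    obtain ⟨a₁, ha₁, h2⟩ := (mem_uran hA).1 h1
    obtain ⟨a₀, ha₀, h3, h4⟩ := hA2 _ ha₁ _ ha'
    refine ⟨b * a₀, ⟨a₀, ha₀, rfl⟩, le_trans ?_ hx⟩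
    have h5 : a₀ * a₀⁻¹ ≤ c⁻¹ * c := (mul_le_mul_self h3 (inv_le_inv_self h3)).trans h2
    calc b * a₀ = b * ((a₀ * a₀⁻¹) * a₀) := by rw [mul_inv_mul]
      _ ≤ b * ((c⁻¹ * c) * a') := mul_le_mul_self le_rfl (mul_le_mul_self h5 h4)
      _ = (b * (c⁻¹ * c)) * a' := by simp only [mul_assoc]
      _ = c * a' := by rw [← eq_mul_of_le hcb]
      _ ≤ b' * a' := mul_le_mul_self hcb' le_rfl
  · rintro ⟨_, ⟨a, ha, rfl⟩, hx⟩
    exact ⟨b * a, ⟨b, hb, a, ha, rfl⟩, hx⟩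

theorem ultra_mul {A B : Set S} (hA : IsUltra A) (hB : IsUltra B) (h : udom B = uran A) :
    IsUltra (up (B * A)) := by
  obtain ⟨⟨b, hb⟩, -, -⟩ := filter_iff.1 hB.1.1
  rw [up_mul_eq hA.1.1 hB.1.1 h hb]
  exact translate_ultra hA (h ▸ (mem_udom hB.1.1).2 ⟨b, hb, le_rfl⟩)

theorem udom_mul {A B : Set S} (hA : IsUltra A) (hB : IsUltra B) (h : udom B = uran A) :
    udom (up (B * A)) = udom A := by
  have hBA := ultra_mul hA hB h
  obtain ⟨-, hA2, -⟩ := filter_iff.1 hA.1.1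
  ext x
  rw [mem_udom hBA.1.1, mem_udom hA.1.1]
  constructor
  · rintro ⟨y, ⟨_, ⟨b, hb, a, ha, rfl⟩, hy⟩, hx⟩
    have h1 : b⁻¹ * b ∈ uran A := h ▸ (mem_udom hB.1.1).2 ⟨b, hb, le_rfl⟩
    obtain ⟨a₁, ha₁, h2⟩ := (mem_uran hA.1.1).1 h1
    obtain ⟨c, hc, hc1, hca⟩ := hA2 _ ha₁ _ ha
    refine ⟨c, hc, le_trans ?_ hx⟩
    have h5 : c * c⁻¹ ≤ b⁻¹ * b := (mul_le_mul_self hc1 (inv_le_inv_self hc1)).trans h2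
    calc c⁻¹ * c = c⁻¹ * ((c * c⁻¹) * c) := by rw [mul_inv_mul]
      _ ≤ a⁻¹ * ((b⁻¹ * b) * a) :=
        mul_le_mul_self (inv_le_inv_self hca) (mul_le_mul_self h5 hca)
      _ = (b * a)⁻¹ * (b * a) := by rw [mul_inv_rev_self]; simp only [mul_assoc]
      _ ≤ y⁻¹ * y := mul_le_mul_self (inv_le_inv_self hy) hy
  · rintro ⟨a, ha, hx⟩
    obtain ⟨⟨b, hb⟩, -, -⟩ := filter_iff.1 hB.1.1
    refine ⟨b * a, subset_up _ ⟨b, hb, a, ha, rfl⟩, le_trans ?_ hx⟩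
    calc (b * a)⁻¹ * (b * a) = a⁻¹ * ((b⁻¹ * b) * a) := by
          rw [mul_inv_rev_self]; simp only [mul_assoc]
      _ ≤ a⁻¹ * a := mul_le_mul_self le_rfl (idem_mul_le (inv_mul_idem b) a)

theorem uran_mul {A B : Set S} (hA : IsUltra A) (hB : IsUltra B) (h : udom B = uran A) :
    uran (up (B * A)) = uran B := by
  have := udom_mul (ultra_inv hB) (ultra_inv hA) (by rw [udom_inv, uran_inv, h])
  rw [← set_mul_inv, up_inv, udom_inv, udom_inv] at this
  exact this

theorem ultra_udom {A : Set S} (hA : IsUltra A) : IsUltra (udom A) :=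
  ultra_mul hA (ultra_inv hA) (udom_inv A)

theorem ultra_uran {A : Set S} (hA : IsUltra A) : IsUltra (uran A) := by
  rw [← udom_inv]
  exact ultra_udom (ultra_inv hA)

theorem udom_idem {A : Set S} (hA : Order.IsPFilter A) : ∃ e ∈ udom A, e * e = e := by
  obtain ⟨⟨a, ha⟩, -, -⟩ := filter_iff.1 hA
  exact ⟨a⁻¹ * a, (mem_udom hA).2 ⟨a, ha, le_rfl⟩, inv_mul_idem a⟩

theorem udom_of_identity {E : Set S} (hE : Order.IsPFilter E) (h : ∃ e ∈ E, e * e = e) :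
    udom E = E := by
  obtain ⟨e, he, hee⟩ := h
  obtain ⟨-, h2, h3⟩ := filter_iff.1 hE
  have key : ∀ a ∈ E, ∃ c ∈ E, c * c = c ∧ c ≤ a := fun a ha => by
    obtain ⟨c, hc, hca, hce⟩ := h2 _ ha _ he
    exact ⟨c, hc, idem_of_le_idem hee hce, hca⟩
  ext x
  rw [mem_udom hE]
  constructor
  · rintro ⟨a, ha, hx⟩
    obtain ⟨c, hc, hcc, hca⟩ := key a ha
    refine h3 c x (le_trans ?_ hx) hc
    have := mul_le_mul_self (inv_le_inv_self hca) hca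
    rwa [inv_of_idem hcc, hcc] at this
  · intro hx
    obtain ⟨c, hc, hcc, hcx⟩ := key x hx
    exact ⟨c, hc, by rwa [inv_of_idem hcc, hcc]⟩

theorem uran_of_identity {E : Set S} (hE : Order.IsPFilter E) (h : ∃ e ∈ E, e * e = e) :
    uran E = E := by
  obtain ⟨e, he, hee⟩ := h
  have h1 := udom_of_identity (filter_inv hE)
    ⟨e, by rw [Set.mem_inv, inv_of_idem hee]; exact he, hee⟩
  have h2 := udom_of_identity hE ⟨e, he, hee⟩
  have h3 : E⁻¹ = E := by
    conv_lhs => rw [← h2, udom, ← up_inv, set_mul_inv, set_inv_inv]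
    exact h2
  rw [h3] at h1
  rw [← udom_inv, h3, h1]

theorem up_mul_udom {A : Set S} (hA : Order.IsPFilter A) : up (A * udom A) = A := by
  obtain ⟨-, h2, h3⟩ := filter_iff.1 hA
  ext x
  constructor
  · rintro ⟨_, ⟨a, ha, y, hy, rfl⟩, hx⟩
    obtain ⟨b, hb, hby⟩ := (mem_udom hA).1 hy
    obtain ⟨c, hc, hca, hcb⟩ := h2 _ ha _ hb
    refine h3 c x (le_trans ?_ hx) hc
    calc c = c * (c⁻¹ * c) := by rw [← mul_assoc, mul_inv_mul]
      _ ≤ a * y := mul_le_mul_self hca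
        ((mul_le_mul_self (inv_le_inv_self hcb) hcb).trans hby)
  · intro hx
    refine ⟨x * (x⁻¹ * x), ⟨x, hx, _, (mem_udom hA).2 ⟨x, hx, le_rfl⟩, rfl⟩, ?_⟩
    rw [← mul_assoc, mul_inv_mul]

theorem up_uran_mul {A : Set S} (hA : Order.IsPFilter A) : up (uran A * A) = A := by
  have h := up_mul_udom (filter_inv hA)
  rw [udom_inv] at h
  have h1 : (uran A)⁻¹ = uran A := by rw [uran, ← up_inv, set_mul_inv, set_inv_inv]
  rw [← h1, ← set_inv_inv A, ← set_mul_inv, up_inv, set_inv_inv, h, set_inv_inv]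

end Ultra

end InverseMonoidWithZero

open InverseMonoidWithZero in
/-- The space of units of the groupoid of ultrafilters: the identity ultrafilters, that is,
the ultrafilters that contain an idempotent. -/
@[ext]
structure IdentityUltrafilter (S : Type*) [InverseMonoidWithZero S] where
  carrier : Set S
  isUltra : IsUltra carrier
  exists_idem : ∃ e ∈ carrier, e * e = e

namespace IdentityUltrafilter

open InverseMonoidWithZero

variable {S : Type*} [InverseMonoidWithZero S]

/-- The groupoid of ultrafilters. An arrow from `E` to `F` is an ultrafilter `A` with
`𝐝(A) = (A⁻¹ A)↑ = E` and `𝐫(A) = (A A⁻¹)↑ = F`; the product of `B` and `A` is `(B A)↑` and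
the inverse of `A` is `A⁻¹`. -/
instance : Groupoid (IdentityUltrafilter S) where
  Hom E F := {A : Set S // IsUltra A ∧ udom A = E.carrier ∧ uran A = F.carrier}
  id E := ⟨E.carrier, E.isUltra, udom_of_identity E.isUltra.1.1 E.exists_idem,
    uran_of_identity E.isUltra.1.1 E.exists_idem⟩
  comp A B := ⟨up (B.1 * A.1), ultra_mul A.2.1 B.2.1 (B.2.2.1.trans A.2.2.2.symm),
    (udom_mul A.2.1 B.2.1 (B.2.2.1.trans A.2.2.2.symm)).trans A.2.2.1,
    (uran_mul A.2.1 B.2.1 (B.2.2.1.trans A.2.2.2.symm)).trans B.2.2.2⟩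
  inv A := ⟨A.1⁻¹, ultra_inv A.2.1, (udom_inv A.1).trans A.2.2.2,
    (uran_inv A.1).trans A.2.2.1⟩
  id_comp A := Subtype.ext
    ((congrArg (fun E => up (A.1 * E)) A.2.2.1.symm).trans (up_mul_udom A.2.1.1.1))
  comp_id A := Subtype.ext
    ((congrArg (fun E => up (E * A.1)) A.2.2.2.symm).trans (up_uran_mul A.2.1.1.1))
  assoc A B C := Subtype.ext (by
    change up (C.1 * up (B.1 * A.1)) = up (up (C.1 * B.1) * A.1)
    rw [up_mul_up_right, up_mul_up_left, mul_assoc])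
  inv_comp A := Subtype.ext A.2.2.2
  comp_inv A := Subtype.ext A.2.2.1

/-- The topology on the groupoid of ultrafilters: a basis is formed by the sets of all
ultrafilters that contain a given element. -/
instance : TopologicalSpace (Quiver.Total (IdentityUltrafilter S)) :=
  TopologicalSpace.generateFrom {U | ∃ s : S, U = {τ | s ∈ τ.hom.1}}

end IdentityUltrafilter

/-- The set of all arrows of a category. An arrow `a : u ⟶ v` has domain `𝐝(a) = a.left = u`
and codomain `𝐫(a) = a.right = v`. -/
abbrev Arr (V : Type*) [Category V] : Type _ := Quiver.Total V

section Arrows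

variable {V : Type*} [Category V]

/-- `IsProd a b c` means that the product `a b` (first `b`, then `a`) is defined, that is,
`𝐝(a) = 𝐫(b)`, and is equal to `c`. -/
inductive IsProd : Arr V → Arr V → Arr V → Prop
  | mk {u v w : V} (a : v ⟶ w) (b : u ⟶ v) : IsProd ⟨v, w, a⟩ ⟨u, v, b⟩ ⟨u, w, b ≫ a⟩

/-- The identity arrow at an object. -/
def idArr (v : V) : Arr V := ⟨v, v, 𝟙 v⟩

namespace IsProd

theorem exists_of_eq (a b : Arr V) (h : a.left = b.right) : ∃ c, IsProd a b c := by
  obtain ⟨v, w, a⟩ := a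
  obtain ⟨u, v', b⟩ := b
  obtain rfl : v = v' := h
  exact ⟨_, mk a b⟩

theorem unique {a b c c' : Arr V} (h : IsProd a b c) (h' : IsProd a b c') : c = c' := by
  cases h
  cases h'
  rfl

theorem middle {a b c : Arr V} (h : IsProd a b c) : a.left = b.right := by cases h; rfl

theorem left {a b c : Arr V} (h : IsProd a b c) : c.left = b.left := by cases h; rfl

theorem right {a b c : Arr V} (h : IsProd a b c) : c.right = a.right := by cases h; rfl

theorem id_right (a : Arr V) : IsProd a (idArr a.left) a := by
  obtain ⟨u, v, a⟩ := a
  have := mk a (𝟙 u)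
  rwa [Category.id_comp] at this

theorem id_left (a : Arr V) : IsProd (idArr a.right) a a := by
  obtain ⟨u, v, a⟩ := a
  have := mk (𝟙 v) a
  rwa [Category.comp_id] at this

theorem assoc_right {a b c x y : Arr V} (h : IsProd a b x) (h' : IsProd x c y) :
    ∃ z, IsProd b c z ∧ IsProd a z y := by
  cases h with
  | mk a b =>
    cases h' with
    | mk _ c =>
      refine ⟨_, mk b c, ?_⟩
      rw [← Category.assoc]
      exact mk a (c ≫ b)

theorem assoc_left {a b c z y : Arr V} (h : IsProd b c z) (h' : IsProd a z y) :
    ∃ x, IsProd a b x ∧ IsProd x c y := by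
  cases h with
  | mk b c =>
    cases h' with
    | mk a _ =>
      refine ⟨_, mk a b, ?_⟩
      rw [Category.assoc]
      exact mk (b ≫ a) c

end IsProd

/-- The right ideal `X C` generated by a set `X` of arrows. -/
def rightIdeal (X : Set (Arr V)) : Set (Arr V) := {c | ∃ x ∈ X, ∃ s, IsProd x s c}

/-- Finitely generated right ideals; the empty set is one of them. -/
def IsFGRightIdeal (R : Set (Arr V)) : Prop := ∃ X : Set (Arr V), X.Finite ∧ R = rightIdeal X

theorem subset_rightIdeal (X : Set (Arr V)) : X ⊆ rightIdeal X :=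
  fun x hx => ⟨x, hx, _, IsProd.id_right x⟩

/-- The domain of definition of a partial bijection. -/
def pdom (θ : Arr V ≃. Arr V) : Set (Arr V) := {a | ∃ b, b ∈ θ a}

/-- The image of a partial bijection. -/
def pran (θ : Arr V ≃. Arr V) : Set (Arr V) := {b | ∃ a, b ∈ θ a}

/-- A partial bijection `θ` is a morphism if `θ(r s) = θ(r) s` whenever `θ(r)` and `r s` are
defined. -/
def IsMorphism (θ : Arr V ≃. Arr V) : Prop :=
  ∀ r s t r', IsProd r s t → r' ∈ θ r → ∃ t', IsProd r' s t' ∧ t' ∈ θ t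

theorem IsMorphism.left_eq {θ : Arr V ≃. Arr V} (h : IsMorphism θ) {r r' : Arr V}
    (hr : r' ∈ θ r) : r'.left = r.left := by
  obtain ⟨t, ht, -⟩ := h r _ r r' (IsProd.id_right r) hr
  exact ht.middle

theorem IsMorphism.symm {θ : Arr V ≃. Arr V} (h : IsMorphism θ) : IsMorphism θ.symm := by
  intro r s t r' hp hr
  rw [PEquiv.mem_iff_mem] at hr
  obtain ⟨x, hx⟩ := IsProd.exists_of_eq r' s ((h.left_eq hr).symm.trans hp.middle)
  obtain ⟨t', ht', hx'⟩ := h r' s x r hx hr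
  obtain rfl := ht'.unique hp
  exact ⟨x, hx, (PEquiv.mem_iff_mem θ).2 hx'⟩

theorem IsMorphism.trans {θ φ : Arr V ≃. Arr V} (h : IsMorphism θ) (h' : IsMorphism φ) :
    IsMorphism (θ.trans φ) := by
  intro r s t r' hp hr
  obtain ⟨b, hb, hr⟩ := (PEquiv.mem_trans _ _ _ _).1 hr
  obtain ⟨t', ht', hb'⟩ := h r s t b hp hb
  obtain ⟨t'', ht'', hb''⟩ := h' b s t' r' ht' hr
  exact ⟨t'', ht'', (PEquiv.mem_trans _ _ _ _).2 ⟨t', hb', hb''⟩⟩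

theorem IsMorphism.fg_image {θ : Arr V ≃. Arr V} (h : IsMorphism θ) {R : Set (Arr V)}
    (hR : IsFGRightIdeal R) (hd : R ⊆ pdom θ) : IsFGRightIdeal {b | ∃ a ∈ R, b ∈ θ a} := by
  obtain ⟨X, hX, rfl⟩ := hR
  refine ⟨⋃ x ∈ X, {b | b ∈ θ x}, ?_, ?_⟩
  · refine hX.biUnion fun x _ => Set.Subsingleton.finite ?_
    intro b hb c hc
    exact Option.mem_unique hb hc
  · ext c
    constructor
    · rintro ⟨a, ⟨x, hx, s, hs⟩, hc⟩
      obtain ⟨y, hy⟩ := hd (subset_rightIdeal X hx)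
      obtain ⟨t, ht, hta⟩ := h x s a y hs hy
      obtain rfl := Option.mem_unique hc hta
      exact ⟨y, Set.mem_biUnion hx hy, s, ht⟩
    · rintro ⟨y, hy, s, hs⟩
      obtain ⟨x, hx, hy⟩ := Set.mem_iUnion₂.1 hy
      obtain ⟨a, ha⟩ := IsProd.exists_of_eq x s ((h.left_eq hy).symm.trans hs.middle)
      obtain ⟨t, ht, hta⟩ := h x s a y ha hy
      obtain rfl := ht.unique hs
      exact ⟨a, ⟨x, hx, s, ha⟩, hta⟩

theorem pdom_symm (θ : Arr V ≃. Arr V) : pdom θ.symm = pran θ := by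
  ext a
  exact exists_congr fun b => PEquiv.mem_iff_mem θ

theorem pran_symm (θ : Arr V ≃. Arr V) : pran θ.symm = pdom θ := by
  ext a
  exact exists_congr fun b => PEquiv.mem_iff_mem θ

theorem pran_trans (θ φ : Arr V ≃. Arr V) :
    pran (θ.trans φ) = {b | ∃ a ∈ pran θ ∩ pdom φ, b ∈ φ a} := by
  ext c
  constructor
  · rintro ⟨a, ha⟩
    obtain ⟨b, hb, hc⟩ := (PEquiv.mem_trans _ _ _ _).1 ha
    exact ⟨b, ⟨⟨a, hb⟩, ⟨c, hc⟩⟩, hc⟩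
  · rintro ⟨b, ⟨⟨a, ha⟩, -⟩, hc⟩
    exact ⟨a, (PEquiv.mem_trans _ _ _ _).2 ⟨b, ha, hc⟩⟩

/-- Two arrows `a` and `b` are comparable if `a C ∩ b C` is nonempty. -/
def Comparable (a b : Arr V) : Prop := ∃ u v c, IsProd a u c ∧ IsProd b v c

end Arrows

/-- A `k`-graph structure on a category: the category is countable, and there is a functor `deg`
to the monoid `ℕ^k` with the unique factorization property. -/
structure KGraph (k : ℕ) (V : Type*) [Category V] where
  countable : Countable (Arr V)
  deg : Arr V → (Fin k → ℕ)
  deg_id : ∀ v : V, deg (idArr v) = 0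
  deg_prod : ∀ a b c, IsProd a b c → deg c = deg a + deg b
  ufp : ∀ a m n, deg a = m + n →
    ∃! p : Arr V × Arr V, IsProd p.1 p.2 a ∧ deg p.1 = m ∧ deg p.2 = n

namespace KGraph

variable {k : ℕ} {V : Type*} [Category V] (Γ : KGraph k V)

/-- Row finiteness: each vertex receives only finitely many arrows of each degree. -/
class RowFinite : Prop where
  finite : ∀ (e : V) (m : Fin k → ℕ), {a : Arr V | a.right = e ∧ Γ.deg a = m}.Finite

/-- No sources: each vertex receives an arrow of each degree. -/
def NoSources : Prop := ∀ (e : V) (m : Fin k → ℕ), ∃ a : Arr V, a.right = e ∧ Γ.deg a = m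

theorem factor_unique {a x y x' y' : Arr V} (h : IsProd x y a) (h' : IsProd x' y' a)
    (hd : Γ.deg x = Γ.deg x') : x = x' ∧ y = y' := by
  have h1 := Γ.deg_prod _ _ _ h
  have h2 := Γ.deg_prod _ _ _ h'
  have hd' : Γ.deg y' = Γ.deg y := by
    rw [h1, hd] at h2
    exact (add_left_cancel h2).symm
  have := (Γ.ufp a _ _ h1).unique (y₁ := (x, y)) (y₂ := (x', y')) ⟨h, rfl, rfl⟩
    ⟨h', hd.symm, hd'⟩
  exact Prod.mk.inj this

theorem levi {x y u v c : Arr V} (h : IsProd x y c) (h' : IsProd u v c)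
    (hd : Γ.deg u ≤ Γ.deg x) : ∃ t, IsProd u t x ∧ IsProd t y v := by
  obtain ⟨⟨u', t⟩, ⟨h1, h2, -⟩, -⟩ := Γ.ufp x (Γ.deg u) (Γ.deg x - Γ.deg u)
    (add_tsub_cancel_of_le hd).symm
  obtain ⟨z, hz, hz'⟩ := h1.assoc_right h
  obtain ⟨rfl, rfl⟩ := Γ.factor_unique hz' h' h2
  exact ⟨t, h1, hz⟩

theorem deg_le {a b c : Arr V} (h : IsProd a b c) : Γ.deg a ≤ Γ.deg c := by
  rw [Γ.deg_prod _ _ _ h]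
  exact le_self_add

/-- A row-finite `k`-graph is finitely aligned, so that the intersection of two finitely generated
right ideals is finitely generated. -/
theorem fg_inter [Γ.RowFinite] {R R' : Set (Arr V)} (h : IsFGRightIdeal R)
    (h' : IsFGRightIdeal R') : IsFGRightIdeal (R ∩ R') := by
  obtain ⟨X, hX, rfl⟩ := h
  obtain ⟨Y, hY, rfl⟩ := h'
  refine ⟨⋃ x ∈ X, ⋃ y ∈ Y, {e | Γ.deg e = Γ.deg x ⊔ Γ.deg y ∧ (∃ s, IsProd x s e) ∧
    ∃ s, IsProd y s e}, ?_, ?_⟩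
  · refine hX.biUnion fun x _ => hY.biUnion fun y _ => ?_
    refine (RowFinite.finite (Γ := Γ) x.right (Γ.deg x ⊔ Γ.deg y)).subset ?_
    rintro e ⟨h1, ⟨s, h2⟩, -⟩
    exact ⟨h2.right, h1⟩
  · ext c
    constructor
    · rintro ⟨⟨x, hx, s, hs⟩, ⟨y, hy, t, ht⟩⟩
      have hle : Γ.deg x ⊔ Γ.deg y ≤ Γ.deg c := sup_le (Γ.deg_le hs) (Γ.deg_le ht)
      obtain ⟨⟨e, f⟩, ⟨h1, h2, -⟩, -⟩ := Γ.ufp c (Γ.deg x ⊔ Γ.deg y) _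
        (add_tsub_cancel_of_le hle).symm
      refine ⟨e, ?_, f, h1⟩
      refine Set.mem_biUnion hx (Set.mem_biUnion hy ⟨h2, ?_, ?_⟩)
      · obtain ⟨p, hp, -⟩ := Γ.levi h1 hs (by rw [h2]; exact le_sup_left)
        exact ⟨p, hp⟩
      · obtain ⟨p, hp, -⟩ := Γ.levi h1 ht (by rw [h2]; exact le_sup_right)
        exact ⟨p, hp⟩
    · rintro ⟨e, he, f, hf⟩
      obtain ⟨x, hx, he⟩ := Set.mem_iUnion₂.1 he
      obtain ⟨y, hy, -, ⟨s, hs⟩, ⟨t, ht⟩⟩ := Set.mem_iUnion₂.1 he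
      obtain ⟨p, -, hp⟩ := hs.assoc_right hf
      obtain ⟨q, -, hq⟩ := ht.assoc_right hf
      exact ⟨⟨x, hx, p, hp⟩, ⟨y, hy, q, hq⟩⟩

/-- The set `𝖱(C)` of all bijective morphisms between finitely generated right ideals, as a set
of partial bijections of the set of arrows. -/
@[ext]
structure R (Γ : KGraph k V) where
  map : Arr V ≃. Arr V
  fg_dom : IsFGRightIdeal (pdom map)
  fg_ran : IsFGRightIdeal (pran map)
  isMorphism : IsMorphism map

namespace R

variable {Γ}

/-- The inverse of a bijective morphism. -/
instance : Inv Γ.R where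
  inv a := ⟨a.map.symm, by rw [pdom_symm]; exact a.fg_ran, by rw [pran_symm]; exact a.fg_dom,
    a.isMorphism.symm⟩

/-- Composition of bijective morphisms: `a * b` is `b` followed by `a`, defined wherever this
makes sense. -/
instance [Γ.RowFinite] : Mul Γ.R where
  mul a b := ⟨b.map.trans a.map, by
      rw [← pran_symm, PEquiv.symm_trans_rev, pran_trans]
      refine b.isMorphism.symm.fg_image ?_ Set.inter_subset_right
      rw [pran_symm, pdom_symm]
      exact Γ.fg_inter a.fg_dom b.fg_ran, by
      rw [pran_trans]
      exact a.isMorphism.fg_image (Γ.fg_inter b.fg_ran a.fg_dom) Set.inter_subset_right,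
    b.isMorphism.trans a.isMorphism⟩

/-- The identity map of the set of arrows. -/
instance [Finite V] : One Γ.R where
  one := ⟨PEquiv.refl _, ⟨Set.range idArr, Set.finite_range _, by
      ext a
      exact ⟨fun _ => ⟨_, ⟨a.right, rfl⟩, a, IsProd.id_left a⟩, fun _ => ⟨a, rfl⟩⟩⟩,
    ⟨Set.range idArr, Set.finite_range _, by
      ext a
      exact ⟨fun _ => ⟨_, ⟨a.right, rfl⟩, a, IsProd.id_left a⟩, fun _ => ⟨a, rfl⟩⟩⟩, by
    intro r s t r' h hr
    obtain rfl : r = r' := Option.some.inj hr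
    exact ⟨t, h, rfl⟩⟩

/-- The empty map. -/
instance : Zero Γ.R where
  zero := ⟨⊥, ⟨∅, Set.finite_empty, by
      ext a
      simp [pdom, rightIdeal]⟩, ⟨∅, Set.finite_empty, by
      ext a
      simp [pran, rightIdeal]⟩, by
    intro r s t r' h hr
    simp at hr⟩

theorem map_mul [Γ.RowFinite] (a b : Γ.R) : (a * b).map = b.map.trans a.map := rfl

theorem map_inv (a : Γ.R) : a⁻¹.map = a.map.symm := rfl

theorem mem_mul [Γ.RowFinite] {a b : Γ.R} {x z : Arr V} :
    z ∈ (a * b).map x ↔ ∃ y, y ∈ b.map x ∧ z ∈ a.map y := PEquiv.mem_trans _ _ _ _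

theorem mem_inv {a : Γ.R} {x y : Arr V} : y ∈ a⁻¹.map x ↔ x ∈ a.map y := PEquiv.mem_iff_mem _

theorem ext_mem {a b : Γ.R} (h : ∀ x y, y ∈ a.map x ↔ y ∈ b.map x) : a = b :=
  R.ext (PEquiv.ext fun x => Option.ext fun y => h x y)

/-- `𝖱(C)` is an inverse monoid with zero. -/
instance [Finite V] [Γ.RowFinite] : InverseMonoidWithZero Γ.R where
  mul_assoc a b c := R.ext (PEquiv.trans_assoc _ _ _).symm
  one_mul a := R.ext (PEquiv.trans_refl _)
  mul_one a := R.ext (PEquiv.refl_trans _)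
  zero_mul a := R.ext (PEquiv.trans_bot _)
  mul_zero a := R.ext (PEquiv.bot_trans _)
  mul_inv_mul a := ext_mem fun x y => by
    simp only [mem_mul, mem_inv]
    constructor
    · rintro ⟨z, hz, w, hw, hy⟩
      rwa [a.map.inj hz hw]
    · intro h
      exact ⟨y, h, x, h, h⟩
  inv_mul_inv a := ext_mem fun x y => by
    simp only [mem_mul, mem_inv]
    constructor
    · rintro ⟨z, hz, w, hw, hy⟩
      rwa [Option.mem_unique hz hw]
    · intro h
      exact ⟨y, h, x, h, h⟩
  eq_inv a b h1 h2 := ext_mem fun x y => by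
    rw [mem_inv]
    constructor
    · intro h
      rw [← h2] at h
      obtain ⟨z, hz, h⟩ := mem_mul.1 h
      obtain ⟨w, hw, h⟩ := mem_mul.1 h
      have h3 : y ∈ b.map x := by
        rw [← h2]
        exact mem_mul.2 ⟨z, hz, mem_mul.2 ⟨w, hw, h⟩⟩
      obtain rfl := Option.mem_unique hz h3
      rwa [b.map.inj h3 h]
    · intro h
      rw [← h1] at h
      obtain ⟨z, hz, h⟩ := mem_mul.1 h
      obtain ⟨w, hw, h⟩ := mem_mul.1 h
      have h3 : x ∈ a.map y := by
        rw [← h1]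
        exact mem_mul.2 ⟨z, hz, mem_mul.2 ⟨w, hw, h⟩⟩
      obtain rfl := Option.mem_unique hz h3
      rwa [a.map.inj h3 h]

end R

/-- The Boolean inverse monoid `𝖡(C) = 𝖱(C)/≡` of a row-finite `k`-graph with finitely many
vertices, where `≡` is the Lenz congruence. -/
abbrev B [Finite V] [Γ.RowFinite] : Type _ := InverseMonoidWithZero.LenzQuotient Γ.R

theorem left_cancel (Γ : KGraph k V) {a b b' c : Arr V} (h : IsProd a b c) (h' : IsProd a b' c) : b = b' :=
  (Γ.factor_unique h h' rfl).2

open Classical in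
/-- The partial bijection `y s ↦ x s` underlying a basic morphism. -/
noncomputable def basicMap (Γ : KGraph k V) (x y : Arr V) : Arr V ≃. Arr V where
  toFun a := if h : ∃ b s, IsProd y s a ∧ IsProd x s b then some h.choose else none
  invFun b := if h : ∃ a s, IsProd y s a ∧ IsProd x s b then some h.choose else none
  inv a b := by
    have key : ∀ a b b' s s', IsProd y s a → IsProd x s b → IsProd y s' a → IsProd x s' b' →
        b = b' := by
      intro a b b' s s' h1 h2 h3 h4
      obtain rfl := Γ.left_cancel h1 h3
      exact h2.unique h4
    have key' : ∀ a a' b s s', IsProd y s a → IsProd x s b → IsProd y s' a' → IsProd x s' b →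
        a = a' := by
      intro a a' b s s' h1 h2 h3 h4
      obtain rfl := Γ.left_cancel h2 h4
      exact h1.unique h3
    constructor
    · intro h
      split_ifs at h with hb
      · obtain rfl := Option.some.inj h
        obtain ⟨s, h1, h2⟩ := hb.choose_spec
        have ha : ∃ b' s, IsProd y s hb.choose ∧ IsProd x s b' := ⟨b, s, h1, h2⟩
        rw [dif_pos ha]
        obtain ⟨s', h3, h4⟩ := ha.choose_spec
        exact congrArg some (key _ _ _ _ _ h3 h4 h1 h2)
    · intro h
      split_ifs at h with ha
      · obtain rfl := Option.some.inj h
        obtain ⟨s, h1, h2⟩ := ha.choose_spec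
        have hb : ∃ a' s, IsProd y s a' ∧ IsProd x s ha.choose := ⟨a, s, h1, h2⟩
        rw [dif_pos hb]
        obtain ⟨s', h3, h4⟩ := hb.choose_spec
        exact congrArg some (key' _ _ _ _ _ h3 h4 h1 h2)

open Classical in
theorem mem_basicMap {x y a b : Arr V} :
    b ∈ Γ.basicMap x y a ↔ ∃ s, IsProd y s a ∧ IsProd x s b := by
  change (if h : ∃ b s, IsProd y s a ∧ IsProd x s b then some h.choose else none) = some b ↔ _
  constructor
  · intro h
    split_ifs at h with ha
    obtain rfl := Option.some.inj h
    exact ha.choose_spec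
  · rintro ⟨s, h1, h2⟩
    have ha : ∃ b s, IsProd y s a ∧ IsProd x s b := ⟨b, s, h1, h2⟩
    rw [dif_pos ha]
    obtain ⟨s', h3, h4⟩ := ha.choose_spec
    obtain rfl := Γ.left_cancel h1 h3
    exact congrArg some (h4.unique h2)

/-- For `𝐝(x) = 𝐝(y)`, the basic morphism `x y⁻¹` from `y C` to `x C`, given by
`y s ↦ x s`. -/
noncomputable def basic (x y : Arr V) (h : x.left = y.left) : Γ.R where
  map := Γ.basicMap x y
  fg_dom := ⟨{y}, Set.finite_singleton y, by
    ext a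
    constructor
    · rintro ⟨b, hb⟩
      obtain ⟨s, h1, -⟩ := Γ.mem_basicMap.1 hb
      exact ⟨y, rfl, s, h1⟩
    · rintro ⟨_, rfl, s, h1⟩
      obtain ⟨b, hb⟩ := IsProd.exists_of_eq x s (h.trans h1.middle)
      exact ⟨b, Γ.mem_basicMap.2 ⟨s, h1, hb⟩⟩⟩
  fg_ran := ⟨{x}, Set.finite_singleton x, by
    ext b
    constructor
    · rintro ⟨a, ha⟩
      obtain ⟨s, -, h1⟩ := Γ.mem_basicMap.1 ha
      exact ⟨x, rfl, s, h1⟩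
    · rintro ⟨_, rfl, s, h1⟩
      obtain ⟨a, ha⟩ := IsProd.exists_of_eq y s (h.symm.trans h1.middle)
      exact ⟨a, Γ.mem_basicMap.2 ⟨s, ha, h1⟩⟩⟩
  isMorphism := by
    intro r s t r' hp hr
    obtain ⟨p, h1, h2⟩ := Γ.mem_basicMap.1 hr
    obtain ⟨q, h3, h4⟩ := h1.assoc_right hp
    obtain ⟨t', ht'⟩ := IsProd.exists_of_eq x q ((h2.middle.trans h3.right.symm))
    obtain ⟨w, hw, hw'⟩ := IsProd.assoc_left h3 ht'
    obtain rfl := hw.unique h2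
    exact ⟨t', hw', Γ.mem_basicMap.2 ⟨q, h4, ht'⟩⟩

/-- A `k`-tiling (infinite path): a degree-preserving functor from the category of all pairs
`m ≤ n` in `ℕ^k` to the category. -/
@[ext]
structure Tiling where
  seg : ∀ m n : Fin k → ℕ, m ≤ n → Arr V
  seg_self : ∀ m, ∃ v : V, seg m m le_rfl = idArr v
  seg_prod : ∀ (m n p) (h : m ≤ n) (h' : n ≤ p),
    IsProd (seg m n h) (seg n p h') (seg m p (h.trans h'))
  deg_seg : ∀ (m n) (h : m ≤ n), Γ.deg (seg m n h) = n - m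

namespace Tiling

variable {Γ}

/-- The shift `σ^p`. -/
def shift (p : Fin k → ℕ) (w : Γ.Tiling) : Γ.Tiling where
  seg m n h := w.seg (p + m) (p + n) (add_le_add_right h p)
  seg_self m := w.seg_self (p + m)
  seg_prod m n q _ _ := w.seg_prod (p + m) (p + n) (p + q) _ _
  deg_seg m n h := by rw [w.deg_seg, add_tsub_add_eq_tsub_left]

theorem seg_congr (w : Γ.Tiling) {m n m' n' : Fin k → ℕ} (h : m ≤ n) (h1 : m = m')
    (h2 : n = n') : w.seg m n h = w.seg m' n' (h1 ▸ h2 ▸ h) := by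
  subst h1 h2
  rfl

theorem shift_shift (p q : Fin k → ℕ) (w : Γ.Tiling) :
    shift p (shift q w) = shift (q + p) w := by
  refine Tiling.ext (funext fun m => funext fun n => funext fun h => ?_)
  exact w.seg_congr _ (add_assoc _ _ _).symm (add_assoc _ _ _).symm

/-- The path groupoid `𝒢(C)`. An arrow from `w₂` to `w₁` is a triple `(w₁, n, w₂)` such that
`n = l - m` and `σ^l(w₁) = σ^m(w₂)` for some `l, m` in `ℕ^k`. -/
instance : Groupoid Γ.Tiling where
  Hom w₂ w₁ := {n : Fin k → ℤ // ∃ l m : Fin k → ℕ,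
    (∀ i, n i = (l i : ℤ) - (m i : ℤ)) ∧ shift l w₁ = shift m w₂}
  id _ := ⟨0, 0, 0, fun _ => by simp, rfl⟩
  comp {w₃ w₂ w₁} f g := ⟨g.1 + f.1, by
    obtain ⟨l, m, hn, h⟩ := g.2
    obtain ⟨l', m', hn', h'⟩ := f.2
    refine ⟨l + l', m' + m, fun i => ?_, ?_⟩
    · simp only [Pi.add_apply, hn, hn']
      push_cast
      ring
    · rw [← shift_shift, h, shift_shift, add_comm m l', ← shift_shift, h', shift_shift]⟩
  inv f := ⟨-f.1, by
    obtain ⟨l, m, hn, h⟩ := f.2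
    exact ⟨m, l, fun i => by simp [hn], h.symm⟩⟩
  id_comp f := Subtype.ext (add_zero f.1)
  comp_id f := Subtype.ext (zero_add f.1)
  assoc f g h := Subtype.ext (add_assoc h.1 g.1 f.1).symm
  inv_comp f := Subtype.ext (add_neg_cancel f.1)
  comp_inv f := Subtype.ext (neg_add_cancel f.1)

/-- `v = x w` is the concatenation of the arrow `x` and the tiling `w`, where
`w(0, 0) = 𝐝(x)`. -/
def IsConcat (x : Arr V) (w v : Γ.Tiling) : Prop :=
  w.seg 0 0 le_rfl = idArr x.left ∧ v.seg 0 (Γ.deg x) zero_le = x ∧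
    shift (Γ.deg x) v = w

/-- The set `Z(x, y)` of all arrows `(x w, d(x) - d(y), y w)` of the path groupoid, where `w` is a
tiling with `w(0, 0) = 𝐝(x) = 𝐝(y)`. -/
def Z (x y : Arr V) : Set (Quiver.Total Γ.Tiling) :=
  {τ | ∃ w : Γ.Tiling, IsConcat x w τ.right ∧ IsConcat y w τ.left ∧
    ∀ i, τ.hom.1 i = (Γ.deg x i : ℤ) - (Γ.deg y i : ℤ)}

/-- The topology of the path groupoid, with basis the sets `Z(x, y)` with `𝐝(x) = 𝐝(y)`. -/
instance : TopologicalSpace (Quiver.Total Γ.Tiling) :=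
  TopologicalSpace.generateFrom {U | ∃ x y : Arr V, x.left = y.left ∧ U = Z x y}

end Tiling

/-- Good subsets: any two elements are comparable, and every degree occurs. -/
@[ext]
structure GoodSubset where
  carrier : Set (Arr V)
  comparable : ∀ a ∈ carrier, ∀ b ∈ carrier, Comparable a b
  exists_deg : ∀ m : Fin k → ℕ, ∃ a ∈ carrier, Γ.deg a = m

/-- Expanding sets: any two elements are comparable, and arbitrarily large degrees occur. -/
def IsExpanding (A : Set (Arr V)) : Prop :=
  (∀ a ∈ A, ∀ b ∈ A, Comparable a b) ∧ ∀ m : Fin k → ℕ, ∃ a ∈ A, m ≤ Γ.deg a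

end KGraph

section Sets

variable {V : Type*} [Category V]

/-- The set `x⁻¹ A` of all arrows `a` such that `x a` is in `A`. -/
def leftQuot (x : Arr V) (A : Set (Arr V)) : Set (Arr V) := {a | ∃ c ∈ A, IsProd x a c}

/-- The set `x A` of all products `x a` with `a` in `A`. -/
def leftMul (x : Arr V) (A : Set (Arr V)) : Set (Arr V) := {c | ∃ a ∈ A, IsProd x a c}

/-- The set of all prefixes of elements of `A`. -/
def prefixes (A : Set (Arr V)) : Set (Arr V) := {x | ∃ a ∈ A, ∃ u, IsProd x u a}

theorem leftQuot_prod {x y z : Arr V} (h : IsProd x y z) (A : Set (Arr V)) :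
    leftQuot z A = leftQuot y (leftQuot x A) := by
  ext a
  constructor
  · rintro ⟨c, hc, hz⟩
    obtain ⟨d, h1, h2⟩ := h.assoc_right hz
    exact ⟨d, ⟨c, hc, h2⟩, h1⟩
  · rintro ⟨d, ⟨c, hc, h2⟩, h1⟩
    obtain ⟨z', hz', h3⟩ := h1.assoc_left h2
    obtain rfl := h.unique hz'
    exact ⟨c, hc, h3⟩

end Sets

namespace KGraph.GoodSubset

variable {k : ℕ} {V : Type*} [Category V] {Γ : KGraph k V}

theorem prefix_of_deg_le (A : Γ.GoodSubset) {a b : Arr V} (ha : a ∈ A.carrier)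
    (hb : b ∈ A.carrier) (h : Γ.deg a ≤ Γ.deg b) : ∃ t, IsProd a t b := by
  obtain ⟨u, v, c, h1, h2⟩ := A.comparable a ha b hb
  obtain ⟨t, ht, -⟩ := Γ.levi h2 h1 h
  exact ⟨t, ht⟩

/-- `n` is the middle entry of an allowable triple `(A, n, B)`. -/
def Allowable (A : Γ.GoodSubset) (n : Fin k → ℤ) (B : Γ.GoodSubset) : Prop :=
  ∃ x ∈ A.carrier, ∃ y ∈ B.carrier, x.left = y.left ∧
    (∀ i, n i = (Γ.deg x i : ℤ) - (Γ.deg y i : ℤ)) ∧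
    leftQuot x A.carrier = leftQuot y B.carrier

theorem Allowable.refl (A : Γ.GoodSubset) : Allowable A 0 A := by
  obtain ⟨x, hx, -⟩ := A.exists_deg 0
  exact ⟨x, hx, x, hx, rfl, fun i => by simp, rfl⟩

theorem Allowable.neg {A B : Γ.GoodSubset} {n : Fin k → ℤ} (h : Allowable A n B) :
    Allowable B (-n) A := by
  obtain ⟨x, hx, y, hy, h1, h2, h3⟩ := h
  exact ⟨y, hy, x, hx, h1.symm, fun i => by simp [h2], h3.symm⟩

theorem Allowable.add {A B D : Γ.GoodSubset} {m n : Fin k → ℤ} (h : Allowable A m B)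
    (h' : Allowable B n D) : Allowable A (m + n) D := by
  obtain ⟨x, hx, y, hy, h1, h2, h3⟩ := h
  obtain ⟨y', hy', z, hz, h1', h2', h3'⟩ := h'
  obtain ⟨b, hb, hbd⟩ := B.exists_deg (Γ.deg y ⊔ Γ.deg y')
  obtain ⟨t, ht⟩ := B.prefix_of_deg_le hy hb (hbd ▸ le_sup_left)
  obtain ⟨s, hs⟩ := B.prefix_of_deg_le hy' hb (hbd ▸ le_sup_right)
  have htA : t ∈ leftQuot x A.carrier := h3 ▸ ⟨b, hb, ht⟩
  have hsD : s ∈ leftQuot z D.carrier := h3' ▸ ⟨b, hb, hs⟩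
  obtain ⟨a, ha, hxa⟩ := htA
  obtain ⟨c, hc, hzc⟩ := hsD
  refine ⟨a, ha, c, hc, ?_, fun i => ?_, ?_⟩
  · rw [hxa.left, hzc.left, ← ht.left, ← hs.left]
  · have e1 := congrFun (Γ.deg_prod _ _ _ hxa) i
    have e2 := congrFun (Γ.deg_prod _ _ _ hzc) i
    have e3 := congrFun (Γ.deg_prod _ _ _ ht) i
    have e4 := congrFun (Γ.deg_prod _ _ _ hs) i
    have e5 := h2 i
    have e6 := h2' i
    simp only [Pi.add_apply] at *
    omega
  · rw [leftQuot_prod hxa, h3, ← leftQuot_prod ht, leftQuot_prod hs, h3', ← leftQuot_prod hzc]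

/-- The groupoid of allowable triples: an arrow from `B` to `A` is an allowable triple
`(A, n, B)`. -/
instance : Groupoid Γ.GoodSubset where
  Hom B A := {n : Fin k → ℤ // Allowable A n B}
  id A := ⟨0, Allowable.refl A⟩
  comp f g := ⟨g.1 + f.1, g.2.add f.2⟩
  inv f := ⟨-f.1, f.2.neg⟩
  id_comp f := Subtype.ext (add_zero f.1)
  comp_id f := Subtype.ext (zero_add f.1)
  assoc f g h := Subtype.ext (add_assoc h.1 g.1 f.1).symm
  inv_comp f := Subtype.ext (add_neg_cancel f.1)
  comp_inv f := Subtype.ext (neg_add_cancel f.1)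

/-- The set `Z'(x, y)` of all allowable triples `(Pref(x A), d(x) - d(y), Pref(y A))`, where
`A ⊆ 𝐝(x) C` is expanding. -/
def Z' (x y : Arr V) : Set (Quiver.Total Γ.GoodSubset) :=
  {τ | ∃ A : Set (Arr V), Γ.IsExpanding A ∧ (∀ a ∈ A, a.right = x.left) ∧
    τ.right.carrier = prefixes (leftMul x A) ∧ τ.left.carrier = prefixes (leftMul y A) ∧
    ∀ i, τ.hom.1 i = (Γ.deg x i : ℤ) - (Γ.deg y i : ℤ)}

/-- The topology of the groupoid of allowable triples, with basis the sets `Z'(x, y)` with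
`𝐝(x) = 𝐝(y)`. -/
instance : TopologicalSpace (Quiver.Total Γ.GoodSubset) :=
  TopologicalSpace.generateFrom {U | ∃ x y : Arr V, x.left = y.left ∧ U = Z' x y}

end KGraph.GoodSubset

/-- The map on arrows induced by a functor. -/
def arrowMap {X Y : Type*} [Category X] [Category Y] (F : X ⥤ Y) (τ : Quiver.Total X) :
    Quiver.Total Y :=
  ⟨F.obj τ.left, F.obj τ.right, F.map τ.hom⟩

/-- A functor between groupoids whose sets of arrows carry topologies is an isomorphism of
topological groupoids if it induces a homeomorphism between the sets of arrows. (Being bijective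
on arrows, it is then bijective on identities, that is, on objects, as well.) -/
def IsTopGroupoidIso {X Y : Type*} [Groupoid X] [Groupoid Y]
    [TopologicalSpace (Quiver.Total X)] [TopologicalSpace (Quiver.Total Y)] (F : X ⥤ Y) : Prop :=
  IsHomeomorph (arrowMap F)

/-! All three groupoids describe pairs of infinite paths with a common tail, and one relation
carries the comparison. Call (x, y) a witness of (A, n, B) when x ∈ A and y ∈ B have the same
domain, n = d(x) - d(y) and x⁻¹A = y⁻¹B (`GoodSubset.IsWitness`). A good set has exactly one arrow
of each degree and is closed under prefixes. Hence a witness (x, y) can be lengthened to (xt, yt)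
whenever yt ∈ B, and a witness (xs, ys) can be shortened to (x, y) (`IsWitness.extend`,
`IsWitness.of_extend`). Moreover Z'(x, y) is precisely the set of triples witnessed by (x, y)
(`mem_Z'_iff`), so the topologies match as soon as the witnesses do.

Tilings. Every good set is the set of initial segments of a unique tiling: w(m, n) is recovered as
the cofactor of w(0, m) in w(0, n). Stripping w(0, l) from the initial segments of w gives those of
σ^l(w), so σ^l(w₁) = σ^m(w₂) is an equality of left quotients, and Z(x, y) is the preimage of Z'(x,
y).

Ultrafilters. Attach to (A, n, B) the set of classes of all θ with θ(y) = x for some witness (x, y)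
(`filterOf`). If M bounds the degrees of the generators of the domain of θ and d(b) ≥ M, then θ(bs)
= as already forces θ(b) = a (`R.exists_bound`). As witnesses can be lengthened past M, membership
does not depend on the representative modulo ≡, and the filter is maximal (`mk_mem_filterOf`,
`isUltra_filterOf`).

Conversely, let 𝒜 be an ultrafilter with [θ] ∈ 𝒜. The restrictions of θ to the ideals gcC, with g a
generator of the domain and d(c) = m, are finite in number by row finiteness and cover θ because
there are no sources. An ultrafilter meets every finite cover of each of its members
(`ultra_exists_mem_of_cover`), so 𝒜 contains classes [xy⁻¹] with d(x), d(y) arbitrarily large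
(`exists_basicMem`). The prefixes of these x, and of these y, form good sets A and B; d(x) - d(y) is
a constant n; each such (x, y) is a witness. So 𝒜 lies in the ultrafilter of (A, n, B), and
maximality gives equality. -/

section TopologicalGroupoids

/-! ### Functors that are bijective on arrows, and homeomorphisms of generated topologies. -/

theorem IsHomeomorph.of_generateFrom {X Y : Type*} [tX : TopologicalSpace X] [TopologicalSpace Y]
    {g : Set (Set X)} (hg : tX = TopologicalSpace.generateFrom g) {f : X → Y}
    (hf : Function.Bijective f) (hc : Continuous f) (ho : ∀ U ∈ g, IsOpen (f '' U)) :
    IsHomeomorph f := by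
  subst hg
  let _ := TopologicalSpace.generateFrom g
  refine ⟨hc, ?_, hf⟩
  have hs : Continuous (Equiv.ofBijective f hf).symm := continuous_generateFrom_iff.2 fun U hU => by
    rw [← Equiv.image_eq_preimage_symm]
    exact ho U hU
  intro U hU
  have h := hU.preimage hs
  rwa [← Equiv.image_eq_preimage_symm] at h

theorem total_eqToHom {X : Type*} [Category X] {a b a' b' : X} (ha : a = a') (hb : b' = b)
    (f : a' ⟶ b') :
    (⟨a, b, eqToHom ha ≫ f ≫ eqToHom hb⟩ : Quiver.Total X) = ⟨a', b', f⟩ := by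
  subst ha hb
  simp

variable {X Y Z : Type*} [Groupoid X] [Groupoid Y] [Groupoid Z]

section

variable {F : X ⥤ Y}

theorem obj_injective_of_arrowMap (h : Function.Injective (arrowMap F)) :
    Function.Injective F.obj := by
  intro x x' hx
  have key : arrowMap F (idArr x) = arrowMap F (idArr x') := by
    simp only [arrowMap, idArr, F.map_id]
    exact congrArg idArr hx
  exact congrArg Quiver.Total.left (h key)

theorem obj_surjective_of_arrowMap (h : Function.Surjective (arrowMap F)) :
    Function.Surjective F.obj := by
  intro y
  obtain ⟨τ, hτ⟩ := h (idArr y)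
  exact ⟨τ.left, congrArg Quiver.Total.left hτ⟩

theorem map_injective_of_arrowMap (h : Function.Injective (arrowMap F)) {x x' : X}
    {f g : x ⟶ x'} (hfg : F.map f = F.map g) : f = g := by
  have key : arrowMap F ⟨x, x', f⟩ = arrowMap F ⟨x, x', g⟩ := by
    simp only [arrowMap, hfg]
  simpa using h key

theorem map_surjective_of_arrowMap (h : Function.Bijective (arrowMap F)) {x x' : X}
    (g : F.obj x ⟶ F.obj x') : ∃ f : x ⟶ x', F.map f = g := by
  obtain ⟨⟨a, b, f⟩, hτ⟩ := h.2 ⟨_, _, g⟩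
  obtain rfl := obj_injective_of_arrowMap h.1 (congrArg Quiver.Total.left hτ : F.obj a = F.obj x)
  obtain rfl := obj_injective_of_arrowMap h.1 (congrArg Quiver.Total.right hτ : F.obj b = F.obj x')
  exact ⟨f, by simpa [arrowMap] using hτ⟩

/-- A functor that is bijective on arrows has a strict inverse. -/
theorem exists_inverse_of_arrowMap (h : Function.Bijective (arrowMap F)) :
    ∃ K : Y ⥤ X, Function.RightInverse (arrowMap K) (arrowMap F) := by
  choose o ho using obj_surjective_of_arrowMap h.2
  choose m hm using fun (x x' : X) (g : F.obj x ⟶ F.obj x') => map_surjective_of_arrowMap h g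
  refine ⟨{ obj := o
            -- `F.obj (o y) = y` is not definitional, so `f` is transported along `eqToHom` before
            -- it is lifted.
            map := fun {y y'} f => m _ _ (eqToHom (ho y) ≫ f ≫ eqToHom (ho y').symm)
            map_id := fun y => map_injective_of_arrowMap h.1 (by simp [hm])
            map_comp := fun f g => map_injective_of_arrowMap h.1 (by simp [hm]) }, ?_⟩
  intro τ
  simp only [arrowMap, hm]
  exact total_eqToHom _ _ _

end

variable [TopologicalSpace (Quiver.Total X)] [TopologicalSpace (Quiver.Total Y)]
  [TopologicalSpace (Quiver.Total Z)]

theorem IsTopGroupoidIso.exists_inverse {F : X ⥤ Y} (h : IsTopGroupoidIso F) :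
    ∃ K : Y ⥤ X, IsTopGroupoidIso K := by
  obtain ⟨K, hK⟩ := exists_inverse_of_arrowMap (IsHomeomorph.bijective h)
  refine ⟨K, ?_⟩
  have : arrowMap K = (IsHomeomorph.homeomorph _ h).symm := by
    funext τ
    apply (IsHomeomorph.bijective h).1
    rw [hK τ]
    exact ((IsHomeomorph.homeomorph _ h).apply_symm_apply τ).symm
  rw [IsTopGroupoidIso, this]
  exact Homeomorph.isHomeomorph _

theorem IsTopGroupoidIso.comp {F : X ⥤ Y} {G : Y ⥤ Z} (hG : IsTopGroupoidIso G)
    (hF : IsTopGroupoidIso F) : IsTopGroupoidIso (F ⋙ G) :=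
  IsHomeomorph.comp (f := arrowMap F) (g := arrowMap G) hG hF

end TopologicalGroupoids

/-! ### Good subsets, witnesses of allowable triples, and the sets Z'(x, y). -/

namespace KGraph

variable {k : ℕ} {V : Type*} [Category V] (Γ : KGraph k V)

theorem right_cancel (Γ : KGraph k V) {a a' b c : Arr V} (h : IsProd a b c) (h' : IsProd a' b c) :
    a = a' :=
  (Γ.factor_unique h h'
    (add_right_cancel ((Γ.deg_prod _ _ _ h).symm.trans (Γ.deg_prod _ _ _ h')))).1

theorem exists_prefix_deg {a : Arr V} {m : Fin k → ℕ} (h : m ≤ Γ.deg a) :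
    ∃ p t, IsProd p t a ∧ Γ.deg p = m := by
  obtain ⟨⟨p, t⟩, ⟨h1, h2, -⟩, -⟩ := Γ.ufp a m _ (add_tsub_cancel_of_le h).symm
  exact ⟨p, t, h1, h2⟩

theorem eq_of_comparable {a b : Arr V} (h : Comparable a b) (hd : Γ.deg a = Γ.deg b) : a = b := by
  obtain ⟨u, v, c, h1, h2⟩ := h
  exact (Γ.factor_unique h1 h2 hd).1

theorem leftQuot_prefixes_leftMul (Γ : KGraph k V) {x : Arr V} {A : Set (Arr V)}
    (hA : ∀ a ∈ A, a.right = x.left) : leftQuot x (prefixes (leftMul x A)) = prefixes A := by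
  ext a
  constructor
  · rintro ⟨c, ⟨d, ⟨a', ha', hd⟩, u, hu⟩, hc⟩
    obtain ⟨z, hz, hz'⟩ := hc.assoc_right hu
    obtain rfl := Γ.left_cancel hz' hd
    exact ⟨z, ha', u, hz⟩
  · rintro ⟨a', ha', u, hu⟩
    obtain ⟨d, hd⟩ := IsProd.exists_of_eq x a' (hA a' ha').symm
    obtain ⟨c, hc, hc'⟩ := hu.assoc_left hd
    exact ⟨c, ⟨d, ⟨a', ha', hd⟩, u, hc'⟩, hc⟩

theorem IsExpanding.mem_prefixes_leftMul {x : Arr V} {A : Set (Arr V)} (hE : Γ.IsExpanding A)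
    (hA : ∀ a ∈ A, a.right = x.left) : x ∈ prefixes (leftMul x A) := by
  obtain ⟨a, ha, -⟩ := hE.2 0
  obtain ⟨d, hd⟩ := IsProd.exists_of_eq x a (hA a ha).symm
  exact ⟨d, ⟨a, ha, hd⟩, a, hd⟩

namespace GoodSubset

variable {Γ}

theorem eq_of_deg_eq (A : Γ.GoodSubset) {a b : Arr V} (ha : a ∈ A.carrier) (hb : b ∈ A.carrier)
    (h : Γ.deg a = Γ.deg b) : a = b :=
  Γ.eq_of_comparable (A.comparable a ha b hb) h

/-- The arrow of A with the degree of p is itself a prefix of a, and by unique factorization a has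
only one prefix of that degree. -/
theorem mem_of_prefix (A : Γ.GoodSubset) {p t a : Arr V} (h : IsProd p t a)
    (ha : a ∈ A.carrier) : p ∈ A.carrier := by
  obtain ⟨q, hq, hd⟩ := A.exists_deg (Γ.deg p)
  obtain ⟨s, hs⟩ := A.prefix_of_deg_le hq ha (hd ▸ Γ.deg_le h)
  obtain ⟨rfl, -⟩ := Γ.factor_unique h hs hd.symm
  exact hq

/-- Each p ∈ A is a prefix of any shared arrow of degree at least d(p), and B is closed under
prefixes. -/
theorem le_of_cofinal {A B : Γ.GoodSubset}
    (h : ∀ m, ∃ a ∈ A.carrier, a ∈ B.carrier ∧ m ≤ Γ.deg a) : A.carrier ⊆ B.carrier := by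
  intro p hp
  obtain ⟨a, ha, hb, hm⟩ := h (Γ.deg p)
  obtain ⟨t, ht⟩ := A.prefix_of_deg_le hp ha hm
  exact B.mem_of_prefix ht hb

theorem eq_of_cofinal {A B : Γ.GoodSubset}
    (h : ∀ m, ∃ a ∈ A.carrier, a ∈ B.carrier ∧ m ≤ Γ.deg a) : A = B :=
  GoodSubset.ext (Set.Subset.antisymm (le_of_cofinal h) (le_of_cofinal fun m => by
    obtain ⟨a, ha, hb, hm⟩ := h m
    exact ⟨a, hb, ha, hm⟩))

/-- Two arrows `x`, `y` witness that `(A, n, B)` is allowable. -/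
structure IsWitness (A : Γ.GoodSubset) (n : Fin k → ℤ) (B : Γ.GoodSubset) (x y : Arr V) :
    Prop where
  mem_left : x ∈ A.carrier
  mem_right : y ∈ B.carrier
  left_eq : x.left = y.left
  deg_eq : ∀ i, n i = (Γ.deg x i : ℤ) - (Γ.deg y i : ℤ)
  quot_eq : leftQuot x A.carrier = leftQuot y B.carrier

theorem Allowable.exists_isWitness {A B : Γ.GoodSubset} {n : Fin k → ℤ} (h : Allowable A n B) :
    ∃ x y, IsWitness A n B x y := by
  obtain ⟨x, hx, y, hy, h1, h2, h3⟩ := h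
  exact ⟨x, y, hx, hy, h1, h2, h3⟩

namespace IsWitness

variable {A B D : Γ.GoodSubset} {m n : Fin k → ℤ} {x y z a b t : Arr V}

theorem allowable (h : IsWitness A n B x y) : Allowable A n B :=
  ⟨x, h.mem_left, y, h.mem_right, h.left_eq, h.deg_eq, h.quot_eq⟩

theorem refl (hx : x ∈ A.carrier) : IsWitness A 0 A x x := ⟨hx, hx, rfl, fun _ => by simp, rfl⟩

theorem neg (h : IsWitness A n B x y) : IsWitness B (-n) A y x :=
  ⟨h.mem_right, h.mem_left, h.left_eq.symm, fun i => by simp [h.deg_eq], h.quot_eq.symm⟩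

theorem add (h : IsWitness A m B x y) (h' : IsWitness B n D y z) : IsWitness A (m + n) D x z :=
  ⟨h.mem_left, h'.mem_right, h.left_eq.trans h'.left_eq,
    fun i => by simp [h.deg_eq, h'.deg_eq], h.quot_eq.trans h'.quot_eq⟩

/-- The cofactor t lies in y⁻¹B = x⁻¹A, so xt ∈ A; the two left quotients by t of this common set
then agree. -/
theorem extend (h : IsWitness A n B x y) (ht : IsProd y t b) (hb : b ∈ B.carrier) :
    ∃ a, IsProd x t a ∧ IsWitness A n B a b := by
  have h1 : t ∈ leftQuot x A.carrier := h.quot_eq ▸ ⟨b, hb, ht⟩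
  obtain ⟨a, ha, hta⟩ := h1
  refine ⟨a, hta, ha, hb, hta.left.trans ht.left.symm, fun i => ?_, ?_⟩
  · rw [h.deg_eq, Γ.deg_prod _ _ _ hta, Γ.deg_prod _ _ _ ht]
    simp
  · rw [leftQuot_prod hta, leftQuot_prod ht, h.quot_eq]

theorem exists_extend (h : IsWitness A n B x y) (hb : b ∈ B.carrier)
    (hd : Γ.deg y ≤ Γ.deg b) : ∃ t a, IsProd y t b ∧ IsProd x t a ∧ IsWitness A n B a b := by
  obtain ⟨t, ht⟩ := B.prefix_of_deg_le h.mem_right hb hd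
  obtain ⟨a, ha, hw⟩ := h.extend ht hb
  exact ⟨t, a, ht, ha, hw⟩

/-- The numbers n and d(y) fix the degree of the left entry, and A has one arrow of each degree. -/
theorem eq_left (h : IsWitness A n B x y) (h' : IsWitness A n B z y) : x = z :=
  A.eq_of_deg_eq h.mem_left h'.mem_left (funext fun i => by
    have h1 := h.deg_eq i
    have h2 := h'.deg_eq i
    omega)

theorem exists_ge (h : IsWitness A n B x y) (p : Fin k → ℕ) :
    ∃ t a b, IsProd x t a ∧ IsProd y t b ∧ IsWitness A n B a b ∧ p ≤ Γ.deg a ∧ p ≤ Γ.deg b := by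
  -- With this degree the cofactor t of y in b has degree exactly p, so both xt and yt have degree
  -- at least p.
  obtain ⟨b, hb, hd⟩ := B.exists_deg (Γ.deg y + p)
  obtain ⟨t, a, ht, hta, hw⟩ := h.exists_extend hb (hd ▸ le_self_add)
  have hp : Γ.deg t = p := by
    rw [Γ.deg_prod _ _ _ ht] at hd
    exact add_left_cancel hd
  refine ⟨t, a, b, hta, ht, hw, ?_, ?_⟩
  · rw [Γ.deg_prod _ _ _ hta, hp]
    exact le_add_self
  · rw [hd]
    exact le_add_self

end IsWitness

theorem isExpanding_leftQuot {A : Γ.GoodSubset} {x : Arr V} (hx : x ∈ A.carrier) :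
    Γ.IsExpanding (leftQuot x A.carrier) := by
  constructor
  · rintro a ⟨c, hc, ha⟩ b ⟨d, hd, hb⟩
    obtain ⟨u, v, e, hu, hv⟩ := A.comparable c hc d hd
    obtain ⟨p, hp, hp'⟩ := ha.assoc_right hu
    obtain ⟨q, hq, hq'⟩ := hb.assoc_right hv
    obtain rfl := Γ.left_cancel hp' hq'
    exact ⟨u, v, p, hp, hq⟩
  · intro m
    obtain ⟨c, hc, hd⟩ := A.exists_deg (Γ.deg x + m)
    obtain ⟨t, ht⟩ := A.prefix_of_deg_le hx hc (hd ▸ le_self_add)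
    refine ⟨t, ⟨c, hc, ht⟩, ?_⟩
    rw [Γ.deg_prod _ _ _ ht] at hd
    exact (add_left_cancel hd).ge

/-- Any p ∈ A is a prefix of the arrow of A of degree d(x) ⊔ d(p), which also starts with x. -/
theorem prefixes_leftMul_leftQuot {A : Γ.GoodSubset} {x : Arr V} (hx : x ∈ A.carrier) :
    prefixes (leftMul x (leftQuot x A.carrier)) = A.carrier := by
  ext p
  constructor
  · rintro ⟨c, ⟨a, ⟨c', hc', ha⟩, hc⟩, u, hu⟩
    obtain rfl := ha.unique hc
    exact A.mem_of_prefix hu hc'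
  · intro hp
    obtain ⟨c, hc, hd⟩ := A.exists_deg (Γ.deg x ⊔ Γ.deg p)
    obtain ⟨t, ht⟩ := A.prefix_of_deg_le hx hc (hd ▸ le_sup_left)
    obtain ⟨s, hs⟩ := A.prefix_of_deg_le hp hc (hd ▸ le_sup_right)
    exact ⟨c, ⟨t, ⟨c, hc, ht⟩, ht⟩, s, hs⟩

/-- By left cancellation x⁻¹Pref(xA) = Pref(A), which depends on A only; so x and y give equal left
quotients. -/
theorem mem_Z'_iff {x y : Arr V} (h : x.left = y.left) {τ : Quiver.Total Γ.GoodSubset} :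
    τ ∈ Z' x y ↔ IsWitness τ.right τ.hom.1 τ.left x y := by
  constructor
  · rintro ⟨A, hE, hA, h1, h2, hd⟩
    have hA' : ∀ a ∈ A, a.right = y.left := fun a ha => (hA a ha).trans h
    refine ⟨?_, ?_, h, hd, ?_⟩
    · rw [h1]
      exact hE.mem_prefixes_leftMul Γ hA
    · rw [h2]
      exact hE.mem_prefixes_leftMul Γ hA'
    · rw [h1, h2, Γ.leftQuot_prefixes_leftMul hA, Γ.leftQuot_prefixes_leftMul hA']
  · intro hw
    -- Here the expanding set is the common left quotient, from which both good sets are recovered.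
    refine ⟨leftQuot x τ.right.carrier, isExpanding_leftQuot hw.mem_left, ?_,
      (prefixes_leftMul_leftQuot hw.mem_left).symm, ?_, hw.deg_eq⟩
    · rintro a ⟨c, -, hc⟩
      exact hc.middle.symm
    · rw [hw.quot_eq, prefixes_leftMul_leftQuot hw.mem_right]

theorem isOpen_Z' {x y : Arr V} (h : x.left = y.left) : IsOpen (Z' (Γ := Γ) x y) :=
  TopologicalSpace.isOpen_generateFrom_of_mem ⟨x, y, h, rfl⟩

end GoodSubset

/-! ### Tilings correspond to good subsets, and the path groupoid to allowable triples. -/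

namespace Tiling

variable {Γ}

/-- The good subset `{w(0, m)}` of a tiling `w`. -/
def initials (w : Γ.Tiling) : Γ.GoodSubset where
  carrier := {a | ∃ m : Fin k → ℕ, a = w.seg 0 m zero_le}
  comparable := by
    rintro _ ⟨m, rfl⟩ _ ⟨n, rfl⟩
    exact ⟨_, _, _, w.seg_prod 0 m (m ⊔ n) zero_le le_sup_left,
      w.seg_prod 0 n (m ⊔ n) zero_le le_sup_right⟩
  exists_deg m := ⟨_, ⟨m, rfl⟩, by rw [w.deg_seg, tsub_zero]⟩

theorem mem_initials {w : Γ.Tiling} {a : Arr V} :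
    a ∈ w.initials.carrier ↔ w.seg 0 (Γ.deg a) zero_le = a := by
  constructor
  · rintro ⟨m, rfl⟩
    exact w.seg_congr _ rfl (by rw [w.deg_seg, tsub_zero])
  · intro h
    exact ⟨_, h.symm⟩

theorem seg_mem_initials (w : Γ.Tiling) (m : Fin k → ℕ) :
    w.seg 0 m zero_le ∈ w.initials.carrier := ⟨m, rfl⟩

/-- An arrow w(0, m) that starts with w(0, l) has cofactor w(l, m), an initial segment of the
shifted tiling. This turns equality of shifts into equality of left quotients. -/
theorem leftQuot_initials (w : Γ.Tiling) (l : Fin k → ℕ) :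
    leftQuot (w.seg 0 l zero_le) w.initials.carrier = (shift l w).initials.carrier := by
  ext a
  constructor
  · rintro ⟨_, ⟨m, rfl⟩, h⟩
    have hm : m = l + Γ.deg a := by
      have := Γ.deg_prod _ _ _ h
      simpa only [w.deg_seg, tsub_zero] using this
    have h2 := w.seg_prod 0 l m zero_le (hm ▸ le_self_add)
    rw [Γ.left_cancel h h2]
    exact ⟨Γ.deg a, w.seg_congr _ (add_zero l).symm hm⟩
  · rintro ⟨p, rfl⟩
    refine ⟨_, ⟨l + p, rfl⟩, ?_⟩
    have h2 := w.seg_prod 0 l (l + p) zero_le le_self_add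
    rwa [w.seg_congr (m := l) (m' := l + 0) _ (add_zero l).symm rfl] at h2

/-- The degree picks w(0, m) out of the good set, and w(m, n) is then determined by left
cancellation in w(0, n). -/
theorem initials_injective : Function.Injective (initials (Γ := Γ)) := by
  intro w w' h
  have h0 : ∀ m, w.seg 0 m zero_le = w'.seg 0 m zero_le := fun m =>
    w'.initials.eq_of_deg_eq (h ▸ w.seg_mem_initials m) (w'.seg_mem_initials m)
      (by rw [w.deg_seg, w'.deg_seg])
  refine Tiling.ext (funext fun m => funext fun n => funext fun hmn => ?_)
  have h1 := w.seg_prod 0 m n zero_le hmn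
  rw [h0, h0] at h1
  exact Γ.left_cancel h1 (w'.seg_prod 0 m n zero_le hmn)

/-- Let e(m) be the arrow of degree m in A. The cofactors s(m, n) of e(m) in e(n) multiply correctly
by left cancellation, so they form a tiling. -/
theorem initials_surjective : Function.Surjective (initials (Γ := Γ)) := by
  intro A
  choose e he hd using A.exists_deg
  choose s hs using fun (m n : Fin k → ℕ) (h : m ≤ n) =>
    A.prefix_of_deg_le (he m) (he n) (by rwa [hd, hd])
  have hself : ∀ m, s m m le_rfl = idArr (e m).left := fun m =>
    Γ.left_cancel (hs m m le_rfl) (IsProd.id_right _)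
  have hdeg : ∀ (m n) (h : m ≤ n), Γ.deg (s m n h) = n - m := fun m n h => by
    have := Γ.deg_prod _ _ _ (hs m n h)
    rw [hd, hd] at this
    exact (tsub_eq_of_eq_add_rev this).symm
  refine ⟨⟨s, fun m => ⟨_, hself m⟩, fun m n p h h' => ?_, hdeg⟩, ?_⟩
  · obtain ⟨z, hz, hz'⟩ := (hs m n h).assoc_right (hs n p h')
    rwa [Γ.left_cancel hz' (hs m p (h.trans h'))] at hz
  -- Both e(0) and the identity at the codomain are prefixes of e(m) of degree 0, so their cofactors
  -- s(0, m) and e(m) coincide.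
  · have h0 : ∀ m, s 0 m zero_le = e m := fun m => by
      obtain ⟨v, hv⟩ : ∃ v, e 0 = idArr v := by
        refine ⟨(e 0).right, ?_⟩
        exact (Γ.factor_unique (IsProd.id_left (e 0)) (IsProd.id_right (e 0))
          (by rw [Γ.deg_id, hd])).1.symm
      have h1 := hs 0 m zero_le
      have h2 := IsProd.id_left (e m)
      exact (Γ.factor_unique h1 h2 (by rw [hd, Γ.deg_id])).2
    refine GoodSubset.ext (Set.ext fun a => ⟨?_, fun ha => ?_⟩)
    · rintro ⟨m, rfl⟩
      change s 0 m zero_le ∈ A.carrier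
      rw [h0]
      exact he m
    · refine ⟨Γ.deg a, ?_⟩
      exact (A.eq_of_deg_eq ha (he _) (hd _).symm).trans (h0 _).symm

/-- Supplies the condition w(0, 0) = 𝐝(x) that `IsConcat` imposes on the tail. -/
theorem left_seg (w : Γ.Tiling) (m : Fin k → ℕ) :
    idArr (w.seg 0 m zero_le).left = (shift m w).seg 0 0 le_rfl := by
  have h1 : (shift m w).seg 0 0 le_rfl = w.seg m m le_rfl :=
    w.seg_congr _ (add_zero m) (add_zero m)
  obtain ⟨v, hv⟩ := w.seg_self m
  have h2 := (w.seg_prod 0 m m zero_le le_rfl).middle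
  rw [h1, h2, hv]
  rfl

open GoodSubset in
theorem isWitness_initials_iff {w₁ w₂ : Γ.Tiling} {n : Fin k → ℤ} {x y : Arr V} :
    IsWitness w₁.initials n w₂.initials x y ↔
      w₁.seg 0 (Γ.deg x) zero_le = x ∧ w₂.seg 0 (Γ.deg y) zero_le = y ∧
        shift (Γ.deg x) w₁ = shift (Γ.deg y) w₂ ∧
        ∀ i, n i = (Γ.deg x i : ℤ) - (Γ.deg y i : ℤ) := by
  constructor
  · rintro ⟨hx, hy, -, hd, hq⟩
    rw [mem_initials] at hx hy
    refine ⟨hx, hy, initials_injective (GoodSubset.ext ?_), hd⟩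
    rw [← leftQuot_initials, ← leftQuot_initials, hx, hy, hq]
  · rintro ⟨hx, hy, hs, hd⟩
    refine ⟨mem_initials.2 hx, mem_initials.2 hy, ?_, hd, ?_⟩
    · have h1 := w₁.left_seg (Γ.deg x)
      rw [hs, ← w₂.left_seg, hx, hy] at h1
      have h2 := congrArg Quiver.Total.left h1
      exact h2
    · have h1 := w₁.leftQuot_initials (Γ.deg x)
      have h2 := w₂.leftQuot_initials (Γ.deg y)
      rw [hx] at h1
      rw [hy] at h2
      rw [h1, h2, hs]

theorem mem_Z_iff {x y : Arr V} (h : x.left = y.left) {τ : Quiver.Total Γ.Tiling} :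
    τ ∈ Z x y ↔
      GoodSubset.IsWitness τ.right.initials τ.hom.1 τ.left.initials x y := by
  rw [isWitness_initials_iff]
  constructor
  · rintro ⟨w, ⟨-, h1, h2⟩, ⟨-, h3, h4⟩, h5⟩
    exact ⟨h1, h3, h2.trans h4.symm, h5⟩
  · rintro ⟨h1, h2, h3, h4⟩
    refine ⟨_, ⟨?_, h1, rfl⟩, ⟨?_, h2, h3.symm⟩, h4⟩
    · rw [← left_seg, h1]
    · rw [← left_seg, h1, h]

theorem allowable_initials_iff {w₁ w₂ : Γ.Tiling} {n : Fin k → ℤ} :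
    GoodSubset.Allowable w₁.initials n w₂.initials ↔
      ∃ l m : Fin k → ℕ, (∀ i, n i = (l i : ℤ) - (m i : ℤ)) ∧ shift l w₁ = shift m w₂ := by
  constructor
  · intro h
    obtain ⟨x, y, hw⟩ := h.exists_isWitness
    obtain ⟨-, -, h3, h4⟩ := isWitness_initials_iff.1 hw
    exact ⟨_, _, h4, h3⟩
  · rintro ⟨l, m, hn, hs⟩
    have h1 : Γ.deg (w₁.seg 0 l zero_le) = l := by rw [w₁.deg_seg, tsub_zero]
    have h2 : Γ.deg (w₂.seg 0 m zero_le) = m := by rw [w₂.deg_seg, tsub_zero]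
    refine (isWitness_initials_iff (x := w₁.seg 0 l zero_le)
      (y := w₂.seg 0 m zero_le).2 ⟨?_, ?_, ?_, ?_⟩).allowable
    · exact w₁.seg_congr _ rfl h1
    · exact w₂.seg_congr _ rfl h2
    · rw [h1, h2, hs]
    · rw [h1, h2]
      exact hn

/-- The functor `(w₁, n, w₂) ↦ (𝒞_{w₁}, n, 𝒞_{w₂})` from the path groupoid to the groupoid of
allowable triples. -/
def initialsFunctor (Γ : KGraph k V) : Γ.Tiling ⥤ Γ.GoodSubset where
  obj := initials
  map f := ⟨f.1, allowable_initials_iff.2 f.2⟩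
  map_id _ := rfl
  map_comp _ _ := rfl

theorem arrowMap_initialsFunctor_bijective :
    Function.Bijective (arrowMap (initialsFunctor Γ)) := by
  constructor
  · rintro ⟨a, b, f⟩ ⟨a', b', f'⟩ h
    obtain rfl := initials_injective (congrArg Quiver.Total.left h : a.initials = a'.initials)
    obtain rfl := initials_injective (congrArg Quiver.Total.right h : b.initials = b'.initials)
    have h1 := congrArg (fun τ : Quiver.Total Γ.GoodSubset => τ.hom.1) h
    obtain rfl : f = f' := Subtype.ext h1
    rfl
  · rintro ⟨A, B, f⟩
    obtain ⟨a, rfl⟩ := initials_surjective A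
    obtain ⟨b, rfl⟩ := initials_surjective B
    exact ⟨⟨a, b, ⟨f.1, allowable_initials_iff.1 f.2⟩⟩, rfl⟩

theorem arrowMap_initialsFunctor_preimage_Z' {x y : Arr V} (h : x.left = y.left) :
    arrowMap (initialsFunctor Γ) ⁻¹' GoodSubset.Z' x y = Z x y := by
  ext τ
  rw [mem_Z_iff h]
  exact GoodSubset.mem_Z'_iff h

theorem isTopGroupoidIso_initialsFunctor : IsTopGroupoidIso (initialsFunctor Γ) := by
  refine IsHomeomorph.of_generateFrom rfl arrowMap_initialsFunctor_bijective
    (continuous_generateFrom_iff.2 ?_) ?_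
  · rintro _ ⟨x, y, h, rfl⟩
    rw [arrowMap_initialsFunctor_preimage_Z' h]
    exact TopologicalSpace.isOpen_generateFrom_of_mem ⟨x, y, h, rfl⟩
  · rintro _ ⟨x, y, h, rfl⟩
    rw [← arrowMap_initialsFunctor_preimage_Z' h,
      Set.image_preimage_eq _ arrowMap_initialsFunctor_bijective.2]
    exact GoodSubset.isOpen_Z' h

end Tiling

end KGraph

/-! ### Ultrafilters and finite covers; the natural order of the Lenz quotient. -/

namespace InverseMonoidWithZero

variable {S : Type*} [InverseMonoidWithZero S]

theorem eq_zero_of_le_zero {a : S} (h : a ≤ 0) : a = 0 := by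
  rw [le_def, zero_mul, zero_mul] at h
  exact h

/-- If t meets every member of A, adjoining t to A still generates a proper filter, so t ∈ A by
maximality. -/
theorem ultra_mem_or {A : Set S} (hA : IsUltra A) {s t : S} (hs : s ∈ A) (hts : t ≤ s) :
    t ∈ A ∨ ∃ a ∈ A, t * (a⁻¹ * a) = 0 := by
  by_contra! hcon
  obtain ⟨htA, h0⟩ := hcon
  obtain ⟨-, h2, h3⟩ := filter_iff.1 hA.1.1
  have mono : ∀ {a c : S}, c ≤ a → t * (c⁻¹ * c) ≤ t * (a⁻¹ * a) := fun h =>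
    mul_le_mul_self le_rfl (mul_le_mul_self (inv_le_inv_self h) h)
  -- This filter contains t. It contains A because t ≤ s: for c ∈ A below both a and s, t c⁻¹c ≤ s
  -- c⁻¹c = c ≤ a.
  let B : Set S := up ((fun a => t * (a⁻¹ * a)) '' A)
  have hB : Order.IsPFilter B ∧ (0 : S) ∉ B := by
    refine ⟨filter_iff.2 ⟨⟨_, subset_up _ ⟨s, hs, rfl⟩⟩, ?_, ?_⟩, ?_⟩
    · rintro x ⟨_, ⟨a, ha, rfl⟩, hx⟩ y ⟨_, ⟨b, hb, rfl⟩, hy⟩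
      obtain ⟨c, hc, hca, hcb⟩ := h2 _ ha _ hb
      exact ⟨_, subset_up _ ⟨c, hc, rfl⟩, (mono hca).trans hx, (mono hcb).trans hy⟩
    · rintro x y hxy ⟨z, hz, hzx⟩
      exact ⟨z, hz, hzx.trans hxy⟩
    · rintro ⟨_, ⟨a, ha, rfl⟩, h⟩
      exact h0 a ha (eq_zero_of_le_zero h)
  refine htA (hA.2 hB ?_ ⟨_, ⟨s, hs, rfl⟩, mul_idem_le (inv_mul_idem s) t⟩)
  intro a ha
  obtain ⟨c, hc, hca, hcs⟩ := h2 _ ha _ hs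
  refine ⟨_, ⟨c, hc, rfl⟩, le_trans ?_ hca⟩
  calc t * (c⁻¹ * c) ≤ s * (c⁻¹ * c) := mul_le_mul_self hts le_rfl
    _ = c := (eq_mul_of_le hcs).symm

/-- An ultrafilter that contains `s` contains a member of every finite cover of `s`. -/
theorem ultra_exists_mem_of_cover {A : Set S} (hA : IsUltra A) {s : S} (hs : s ∈ A) {T : Set S}
    (hT : T.Finite) (hTs : ∀ t ∈ T, t ≤ s)
    (hcov : ∀ z : S, z ≠ 0 → z ≤ s → ∃ t ∈ T, ∃ w : S, w ≠ 0 ∧ w ≤ z ∧ w ≤ t) :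
    ∃ t ∈ T, t ∈ A := by
  by_contra! hcon
  obtain ⟨-, h2, h3⟩ := filter_iff.1 hA.1.1
  -- If no member of T were in A, each would be annihilated by the domain of some member of A;
  -- finitely many such members have a common lower bound in A.
  have key : ∃ c ∈ A, c ≤ s ∧ ∀ t ∈ T, t * (c⁻¹ * c) = 0 := by
    clear hcov
    induction T, hT using Set.Finite.induction_on with
    | empty => exact ⟨s, hs, le_rfl, by simp⟩
    | @insert t T _ _ ih =>
      obtain ⟨c, hc, hcs, hcT⟩ := ih (fun t ht => hTs t (Set.mem_insert_of_mem _ ht))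
        (fun t ht => hcon t (Set.mem_insert_of_mem _ ht))
      obtain ⟨a, ha, hta⟩ := (ultra_mem_or hA hs (hTs t (Set.mem_insert _ _))).resolve_left
        (hcon t (Set.mem_insert _ _))
      obtain ⟨d, hd, hda, hdc⟩ := h2 _ ha _ hc
      have mono : ∀ {a u : S}, d ≤ a → u * (a⁻¹ * a) = 0 → u * (d⁻¹ * d) = 0 := fun h hu =>
        eq_zero_of_le_zero
          (hu ▸ mul_le_mul_self le_rfl (mul_le_mul_self (inv_le_inv_self h) h))
      refine ⟨d, hd, hdc.trans hcs, ?_⟩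
      rintro u (rfl | hu)
      · exact mono hda hta
      · exact mono hdc (hcT u hu)
  obtain ⟨c, hc, hcs, hcT⟩ := key
  -- The cover property at c gives a nonzero w below both c and some t ∈ T, which contradicts t c⁻¹c
  -- = 0.
  obtain ⟨t, ht, w, hw, hwc, hwt⟩ := hcov c (fun h => hA.1.2 (h ▸ hc)) hcs
  refine hw (eq_zero_of_le_zero ?_)
  rw [← hcT t ht]
  calc w = t * (w⁻¹ * w) := eq_mul_of_le hwt
    _ ≤ t * (c⁻¹ * c) := mul_le_mul_self le_rfl (mul_le_mul_self (inv_le_inv_self hwc) hwc)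

theorem ultra_eq_of_subset {A B : Set S} (hA : IsUltra A) (hB : IsUltra B) (h : A ⊆ B) : A = B :=
  Set.Subset.antisymm h (hA.2 hB.1 h)

theorem lenz_mk_le {a b : S} (h : a ≤ b) : (a : LenzQuotient S) ≤ b :=
  congrArg (fun x : S => (x : LenzQuotient S)) h

theorem lenz_mk_ne_zero {a : S} (h : a ≠ 0) : (a : LenzQuotient S) ≠ 0 := by
  intro h0
  obtain ⟨z, hz, -, hz0⟩ := ((Con.eq (lenz S)).1 (h0 : (a : LenzQuotient S) = (0 : S))).1 a h le_rfl
  exact hz (eq_zero_of_le_zero hz0)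

/-- Idempotents of the quotient lift to idempotents, so q = [a][e] = [ae] with ae ≤ a. -/
theorem lenz_exists_le_mk {q : LenzQuotient S} {a : S} (h : q ≤ a) :
    ∃ b : S, b ≤ a ∧ (b : LenzQuotient S) = q := by
  obtain ⟨e', he', rfl⟩ := le_iff_idem.1 h
  obtain ⟨e, he, rfl⟩ := lenz_lift_idem e' he'
  exact ⟨a * e, mul_idem_le he a, rfl⟩

/-- Lift q below a and below b. The two lifts are equivalent and nonzero, so they have a common
nonzero lower bound. -/
theorem lenz_exists_le_of_le_mk {q : LenzQuotient S} (hq : q ≠ 0) {a b : S}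
    (ha : q ≤ a) (hb : q ≤ b) : ∃ c : S, c ≠ 0 ∧ c ≤ a ∧ c ≤ b := by
  obtain ⟨a', ha', rfl⟩ := lenz_exists_le_mk ha
  obtain ⟨b', hb', h⟩ := lenz_exists_le_mk hb
  obtain ⟨c, hc, hca, hcb⟩ :=
    ((Con.eq (lenz S)).1 h.symm).1 a' (fun h0 => hq (by rw [h0]; rfl)) le_rfl
  exact ⟨c, hc, hca.trans ha', hcb.trans hb'⟩

end InverseMonoidWithZero

namespace IdentityUltrafilter

theorem total_ext {S : Type*} [InverseMonoidWithZero S]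
    {σ τ : Quiver.Total (IdentityUltrafilter S)} (h : σ.hom.1 = τ.hom.1) : σ = τ := by
  obtain ⟨E, F, A, hA, hE, hF⟩ := σ
  obtain ⟨E', F', A', hA', hE', hF'⟩ := τ
  obtain rfl : A = A' := h
  obtain rfl : E = E' := IdentityUltrafilter.ext (hE.symm.trans hE')
  obtain rfl : F = F' := IdentityUltrafilter.ext (hF.symm.trans hF')
  rfl

end IdentityUltrafilter

/-! ### From allowable triples to ultrafilters. -/

namespace KGraph

open InverseMonoidWithZero

variable {k : ℕ} {V : Type*} [Category V] {Γ : KGraph k V}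

theorem exists_deg_bound (Γ : KGraph k V) {X : Set (Arr V)} (hX : X.Finite) :
    ∃ M, ∀ a ∈ X, Γ.deg a ≤ M := by
  obtain ⟨M, hM⟩ := (hX.image Γ.deg).bddAbove
  exact ⟨M, fun a ha => hM ⟨a, ha, rfl⟩⟩

theorem mem_basic {x y a b : Arr V} {h : x.left = y.left} :
    b ∈ (Γ.basic x y h).map a ↔ ∃ s, IsProd y s a ∧ IsProd x s b := Γ.mem_basicMap

theorem self_mem_basic {x y : Arr V} (h : x.left = y.left) : x ∈ (Γ.basic x y h).map y := by
  refine mem_basic.2 ⟨_, IsProd.id_right y, ?_⟩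
  rw [← h]
  exact IsProd.id_right x

theorem basic_inv {x y : Arr V} (h : x.left = y.left) :
    (Γ.basic x y h)⁻¹ = Γ.basic y x h.symm := R.ext_mem fun a b => by
  rw [R.mem_inv, mem_basic, mem_basic]
  exact exists_congr fun s => and_comm

namespace R

/-- A morphism `θ` is determined at all arrows of large degree by its values at extensions. -/
theorem exists_bound (θ : Γ.R) : ∃ M, ∀ a b d a' b', M ≤ Γ.deg a → IsProd a d a' →
    IsProd b d b' → b' ∈ θ.map a' → b ∈ θ.map a := by
  obtain ⟨X, hX, hd⟩ := θ.fg_dom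
  obtain ⟨M, hM⟩ := Γ.exists_deg_bound hX
  refine ⟨M, fun a b d a' b' hMa ha hb hm => ?_⟩
  have h1 : a' ∈ rightIdeal X := hd ▸ ⟨b', hm⟩
  obtain ⟨g, hg, s, hs⟩ := h1
  -- A generator g that is a prefix of ad has degree at most d(a), hence is already a prefix of a.
  -- So θ is defined at a, and right cancellation of d gives its value.
  obtain ⟨t, ht, -⟩ := Γ.levi ha hs ((hM g hg).trans hMa)
  have h2 : a ∈ pdom θ.map := hd ▸ ⟨g, hg, t, ht⟩
  obtain ⟨c, hc⟩ := h2
  obtain ⟨c', hc', hm'⟩ := θ.isMorphism a d a' c ha hc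
  obtain rfl := Option.mem_unique hm hm'
  obtain rfl := Γ.right_cancel hc' hb
  exact hc

theorem ne_zero_iff {a : Γ.R} : a ≠ 0 ↔ ∃ x y, y ∈ a.map x := by
  constructor
  · intro h
    by_contra! hcon
    refine h (ext_mem fun x y => ⟨fun hy => absurd hy (hcon x y), fun hy => ?_⟩)
    exact absurd hy (Option.not_mem_none y)
  · rintro ⟨x, y, hy⟩ rfl
    exact Option.not_mem_none y hy

theorem basic_ne_zero {x y : Arr V} (h : x.left = y.left) : Γ.basic x y h ≠ 0 :=
  ne_zero_iff.2 ⟨_, _, self_mem_basic h⟩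

variable [Finite V] [Γ.RowFinite]

theorem le_iff {a b : Γ.R} : a ≤ b ↔ ∀ x y, y ∈ a.map x → y ∈ b.map x := by
  constructor
  · intro h x y hy
    have h' : y ∈ (b * a⁻¹ * a).map x := by
      rw [← le_def.1 h]
      exact hy
    obtain ⟨z, hz, h'⟩ := mem_mul.1 h'
    obtain ⟨w, hw, h'⟩ := mem_mul.1 h'
    rwa [a.map.inj hz (mem_inv.1 hw)]
  · intro h
    refine le_def.2 (ext_mem fun x y => ?_)
    simp only [mem_mul, mem_inv]
    constructor
    · intro hy
      exact ⟨y, hy, x, hy, h x y hy⟩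
    · rintro ⟨z, hz, w, hw, hy⟩
      obtain rfl := a.map.inj hz hw
      rwa [Option.mem_unique hy (h _ _ hz)]

/-- Since θ(ys) = θ(y)s = xs, the morphism xy⁻¹ is the restriction of θ to yC. -/
theorem basic_le {θ : Γ.R} {x y : Arr V} (hx : x ∈ θ.map y) (h : x.left = y.left) :
    Γ.basic x y h ≤ θ := le_iff.2 fun a b hb => by
  obtain ⟨s, hs, hs'⟩ := mem_basic.1 hb
  obtain ⟨t, ht, hm⟩ := θ.isMorphism y s a x hs hx
  rwa [hs'.unique ht]

theorem exists_common {θ φ : Γ.R} {q : Γ.B} (hq : q ≠ 0) (h : q ≤ (θ : Γ.B)) (h' : q ≤ (φ : Γ.B)) :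
    ∃ a b, b ∈ θ.map a ∧ b ∈ φ.map a := by
  obtain ⟨c, hc, h1, h2⟩ := lenz_exists_le_of_le_mk hq h h'
  obtain ⟨a, b, hb⟩ := ne_zero_iff.1 hc
  exact ⟨a, b, le_iff.1 h1 _ _ hb, le_iff.1 h2 _ _ hb⟩

end R

namespace GoodSubset

/-- Write x = x, a = xs, b = ys. If xt ∈ A, some arrow of A has the two forms xsu = xtv, so su = tv.
The witness (a, b) transfers u to B, so ysu = ytv ∈ B, and its prefix yt is in B. -/
theorem IsWitness.leftQuot_subset {A B : Γ.GoodSubset} {n : Fin k → ℤ} {x y s a b : Arr V}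
    (h : IsWitness A n B a b) (hx : IsProd x s a) (hy : IsProd y s b) :
    leftQuot x A.carrier ⊆ leftQuot y B.carrier := by
  rintro t ⟨c, hc, ht⟩
  obtain ⟨a', ha', hd⟩ := A.exists_deg (Γ.deg a ⊔ Γ.deg c)
  obtain ⟨u, hu⟩ := A.prefix_of_deg_le h.mem_left ha' (hd ▸ le_sup_left)
  obtain ⟨v, hv⟩ := A.prefix_of_deg_le hc ha' (hd ▸ le_sup_right)
  obtain ⟨w, hw, hw'⟩ := hx.assoc_right hu
  obtain ⟨w₁, hw₁, hw₁'⟩ := ht.assoc_right hv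
  obtain rfl := Γ.left_cancel hw' hw₁'
  obtain ⟨b', hb', hbu⟩ : u ∈ leftQuot b B.carrier := h.quot_eq ▸ ⟨a', ha', hu⟩
  obtain ⟨w₂, hw₂, hw₂'⟩ := hy.assoc_right hbu
  obtain rfl := hw.unique hw₂
  obtain ⟨e, he, he'⟩ := hw₁.assoc_left hw₂'
  exact ⟨e, B.mem_of_prefix he' hb', he⟩

theorem IsWitness.of_extend {A B : Γ.GoodSubset} {n : Fin k → ℤ} {x y s a b : Arr V}
    (h : IsWitness A n B a b) (hx : IsProd x s a) (hy : IsProd y s b) :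
    IsWitness A n B x y := by
  refine ⟨A.mem_of_prefix hx h.mem_left, B.mem_of_prefix hy h.mem_right,
    hx.middle.trans hy.middle.symm, fun i => ?_, ?_⟩
  · rw [h.deg_eq, Γ.deg_prod _ _ _ hx, Γ.deg_prod _ _ _ hy]
    simp
  · exact Set.Subset.antisymm (h.leftQuot_subset hx hy) (h.neg.leftQuot_subset hy hx)

variable [Finite V] [Γ.RowFinite]

/-- The filter of `𝖡(C)` that belongs to an allowable triple. -/
def filterOf (A : Γ.GoodSubset) (n : Fin k → ℤ) (B : Γ.GoodSubset) : Set Γ.B :=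
  {q | ∃ θ : Γ.R, (θ : Γ.B) = q ∧ ∃ x y, x ∈ θ.map y ∧ IsWitness A n B x y}

variable {A B D : Γ.GoodSubset} {m n : Fin k → ℤ}

/-- Lengthen the witness for θ to (a, b) with d(b) beyond the bound of φ. Then ab⁻¹ ≤ θ, and
equivalence gives a nonzero lower bound of ab⁻¹ and φ. Hence φ(bs) = as for some s, which forces
φ(b) = a. -/
theorem mk_mem_filterOf {φ : Γ.R} :
    (φ : Γ.B) ∈ filterOf A n B ↔ ∃ x y, x ∈ φ.map y ∧ IsWitness A n B x y := by
  constructor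
  · rintro ⟨θ, hθ, x, y, hx, hw⟩
    obtain ⟨M, hM⟩ := φ.exists_bound
    obtain ⟨t, a, b, hxt, hyt, hw', -, hMb⟩ := hw.exists_ge M
    obtain ⟨a', ha', hab⟩ := θ.isMorphism y t b x hyt hx
    obtain rfl := ha'.unique hxt
    obtain ⟨z, hz, hz1, hz2⟩ := ((Con.eq (lenz Γ.R)).1 hθ).1 _ (R.basic_ne_zero hw'.left_eq)
      (R.basic_le hab hw'.left_eq)
    obtain ⟨p, q, hq⟩ := R.ne_zero_iff.1 hz
    obtain ⟨s, hs, hs'⟩ := mem_basic.1 (R.le_iff.1 hz1 _ _ hq)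
    exact ⟨a', b, hM b a' s p q hMb hs hs' (R.le_iff.1 hz2 _ _ hq), hw'⟩
  · intro h
    exact ⟨φ, rfl, h⟩

theorem basic_mem_filterOf {x y : Arr V} (h : x.left = y.left) :
    ((Γ.basic x y h : Γ.R) : Γ.B) ∈ filterOf A n B ↔ IsWitness A n B x y := by
  rw [mk_mem_filterOf]
  constructor
  · rintro ⟨a, b, hab, hw⟩
    obtain ⟨s, hs, hs'⟩ := mem_basic.1 hab
    exact hw.of_extend hs' hs
  · intro hw
    exact ⟨x, y, self_mem_basic h, hw⟩

theorem isProper_filterOf (h : Allowable A n B) :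
    Order.IsPFilter (filterOf A n B) ∧ (0 : Γ.B) ∉ filterOf A n B := by
  refine ⟨filter_iff.2 ⟨?_, ?_, ?_⟩, ?_⟩
  · obtain ⟨x, y, hw⟩ := h.exists_isWitness
    exact ⟨_, (basic_mem_filterOf hw.left_eq).2 hw⟩
  · rintro _ ⟨θ, rfl, x, y, hx, hw⟩ _ ⟨φ, rfl, x', y', hx', hw'⟩
    -- Lengthening both witnesses to the same b gives the same left entry a, so ab⁻¹ is a
    -- restriction of both θ and φ.
    obtain ⟨b, hb, hd⟩ := B.exists_deg (Γ.deg y ⊔ Γ.deg y')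
    obtain ⟨t, a, htb, hta, hwa⟩ := hw.exists_extend hb (hd ▸ le_sup_left)
    obtain ⟨t', a', htb', hta', hwa'⟩ := hw'.exists_extend hb (hd ▸ le_sup_right)
    obtain rfl := hwa.eq_left hwa'
    obtain ⟨c, hc, hc'⟩ := θ.isMorphism _ _ _ _ htb hx
    obtain rfl := hc.unique hta
    obtain ⟨c', hc₁, hc₁'⟩ := φ.isMorphism _ _ _ _ htb' hx'
    obtain rfl := hc₁.unique hta'
    exact ⟨_, (basic_mem_filterOf hwa.left_eq).2 hwa, lenz_mk_le (R.basic_le hc' _),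
      lenz_mk_le (R.basic_le hc₁' _)⟩
  · intro q r
    induction r using Con.induction_on with
    | H φ =>
      intro hqr hq
      obtain ⟨ψ, hψ, rfl⟩ := lenz_exists_le_mk hqr
      obtain ⟨x, y, hx, hw⟩ := mk_mem_filterOf.1 hq
      exact mk_mem_filterOf.2 ⟨x, y, R.le_iff.1 hψ _ _ hx, hw⟩
  · intro h0
    obtain ⟨x, y, hx, -⟩ := (mk_mem_filterOf (φ := 0)).1 h0
    exact R.ne_zero_iff.2 ⟨y, x, hx⟩ rfl

/-- A class [φ] in a larger proper filter has a nonzero lower bound in common with [ab⁻¹] for a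
witness (a, b) with d(b) beyond the bound of φ; hence φ(b) = a. -/
theorem isUltra_filterOf (h : Allowable A n B) : IsUltra (filterOf A n B) := by
  refine ⟨isProper_filterOf h, fun F hF hsub q hq => ?_⟩
  induction q using Con.induction_on with
  | H φ =>
    obtain ⟨M, hM⟩ := φ.exists_bound
    obtain ⟨x, y, hw⟩ := h.exists_isWitness
    obtain ⟨-, a, b, -, -, hw', -, hMb⟩ := hw.exists_ge M
    obtain ⟨-, h2, -⟩ := filter_iff.1 hF.1
    obtain ⟨c, hc, hcφ, hcb⟩ := h2 _ hq _ (hsub ((basic_mem_filterOf hw'.left_eq).2 hw'))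
    obtain ⟨p, q, hpq, hpq'⟩ := R.exists_common (fun h0 => hF.2 (h0 ▸ hc)) hcφ hcb
    obtain ⟨s, hs, hs'⟩ := mem_basic.1 hpq'
    exact mk_mem_filterOf.2 ⟨a, b, hM _ _ _ _ _ hMb hs hs' hpq, hw'⟩

theorem filterOf_mul_subset :
    filterOf A m B * filterOf B n D ⊆ filterOf A (m + n) D := by
  rintro _ ⟨_, ⟨θ, rfl, x, y, hx, hw⟩, _, ⟨φ, rfl, y', z, hy, hw'⟩, rfl⟩
  obtain ⟨b, hb, hd⟩ := B.exists_deg (Γ.deg y ⊔ Γ.deg y')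
  obtain ⟨t, a, htb, hta, hwa⟩ := hw.exists_extend hb (hd ▸ le_sup_left)
  -- The second witness is inverted, because `exists_extend` lengthens along the right-hand good
  -- set, and here that must be B.
  obtain ⟨t', c, htb', htc, hwc⟩ := hw'.neg.exists_extend hb (hd ▸ le_sup_right)
  refine ⟨θ * φ, rfl, a, c, R.mem_mul.2 ⟨b, ?_, ?_⟩, hwa.add (neg_neg n ▸ hwc.neg)⟩
  · obtain ⟨c', hc, hc'⟩ := (φ⁻¹).isMorphism _ _ _ _ htb' (R.mem_inv.2 hy)
    obtain rfl := hc.unique htc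
    exact R.mem_inv.1 hc'
  · obtain ⟨c', hc, hc'⟩ := θ.isMorphism _ _ _ _ htb hx
    rwa [hc.unique hta] at hc'

theorem inv_filterOf_subset : (filterOf A n B)⁻¹ ⊆ filterOf B (-n) A := by
  rintro q ⟨θ, hθ, x, y, hx, hw⟩
  refine ⟨θ⁻¹, ?_, y, x, R.mem_inv.2 hx, hw.neg⟩
  rw [← inv_inv_self q, ← hθ]
  rfl

theorem up_filterOf_subset (h : Allowable A n B) {X : Set Γ.B} (hX : X ⊆ filterOf A n B) :
    up X ⊆ filterOf A n B := by
  rintro q ⟨x, hx, hxq⟩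
  exact (filter_iff.1 (isProper_filterOf h).1).2.2 _ _ hxq (hX hx)

/-- Both sides are ultrafilters, so one inclusion is enough. -/
theorem udom_filterOf (h : Allowable A n B) : udom (filterOf A n B) = filterOf B 0 B := by
  refine ultra_eq_of_subset (ultra_udom (isUltra_filterOf h)) (isUltra_filterOf (Allowable.refl B))
    (up_filterOf_subset (Allowable.refl B) ?_)
  refine (Set.mul_subset_mul_right inv_filterOf_subset).trans (filterOf_mul_subset.trans ?_)
  rw [neg_add_cancel]

theorem uran_filterOf (h : Allowable A n B) : uran (filterOf A n B) = filterOf A 0 A := by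
  refine ultra_eq_of_subset (ultra_uran (isUltra_filterOf h)) (isUltra_filterOf (Allowable.refl A))
    (up_filterOf_subset (Allowable.refl A) ?_)
  refine (Set.mul_subset_mul_left inv_filterOf_subset).trans (filterOf_mul_subset.trans ?_)
  rw [add_neg_cancel]

theorem up_filterOf_mul (h : Allowable A m B) (h' : Allowable B n D) :
    up (filterOf A m B * filterOf B n D) = filterOf A (m + n) D :=
  ultra_eq_of_subset
    (ultra_mul (isUltra_filterOf h') (isUltra_filterOf h)
      ((udom_filterOf h).trans (uran_filterOf h').symm))
    (isUltra_filterOf (h.add h')) (up_filterOf_subset (h.add h') filterOf_mul_subset)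

/-- The classes [ab⁻¹] in the filter are those of the witnesses (a, b), so both triples share
witnesses of arbitrarily large degree. -/
theorem filterOf_injective {A' B' : Γ.GoodSubset} {n' : Fin k → ℤ} (h : Allowable A n B)
    (he : filterOf A n B = filterOf A' n' B') : A = A' ∧ n = n' ∧ B = B' := by
  obtain ⟨x, y, hw⟩ := h.exists_isWitness
  have key : ∀ p, ∃ a b, IsWitness A n B a b ∧ IsWitness A' n' B' a b ∧
      p ≤ Γ.deg a ∧ p ≤ Γ.deg b := fun p => by
    obtain ⟨-, a, b, -, -, hw', ha, hb⟩ := hw.exists_ge p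
    exact ⟨a, b, hw', (basic_mem_filterOf hw'.left_eq).1
      (he ▸ (basic_mem_filterOf hw'.left_eq).2 hw'), ha, hb⟩
  refine ⟨eq_of_cofinal fun p => ?_, ?_, eq_of_cofinal fun p => ?_⟩
  · obtain ⟨a, b, h1, h2, ha, -⟩ := key p
    exact ⟨a, h1.mem_left, h2.mem_left, ha⟩
  · obtain ⟨a, b, h1, h2, -, -⟩ := key 0
    exact funext fun i => (h1.deg_eq i).trans (h2.deg_eq i).symm
  · obtain ⟨a, b, h1, h2, -, hb⟩ := key p
    exact ⟨b, h1.mem_right, h2.mem_right, hb⟩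

variable (Γ) in
/-- The functor from the groupoid of allowable triples to the groupoid of ultrafilters. -/
def filterFunctor : Γ.GoodSubset ⥤ IdentityUltrafilter Γ.B where
  obj A := ⟨filterOf A 0 A, isUltra_filterOf (Allowable.refl A), by
    obtain ⟨e, he, hee⟩ := udom_idem (isProper_filterOf (Allowable.refl A)).1
    exact ⟨e, udom_filterOf (Allowable.refl A) ▸ he, hee⟩⟩
  map {B A} f := ⟨filterOf A f.1 B, isUltra_filterOf f.2, udom_filterOf f.2, uran_filterOf f.2⟩
  map_id _ := rfl
  map_comp f g := Subtype.ext (up_filterOf_mul g.2 f.2).symm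

theorem mem_Z'_iff_basic_mem {x y : Arr V} (h : x.left = y.left) (τ : Quiver.Total Γ.GoodSubset) :
    τ ∈ Z' x y ↔ ((Γ.basic x y h : Γ.R) : Γ.B) ∈ (arrowMap (filterFunctor Γ) τ).hom.1 := by
  rw [mem_Z'_iff h]
  exact (basic_mem_filterOf h).symm

end GoodSubset

/-! ### From ultrafilters back to allowable triples, and the main theorem. -/

section Ultrafilters

variable [Finite V] [Γ.RowFinite] {𝒜 : Set Γ.B}

/-- The class of the basic morphism `x y⁻¹` belongs to `𝒜`. -/
def BasicMem (𝒜 : Set Γ.B) (x y : Arr V) : Prop :=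
  ∃ h : x.left = y.left, ((Γ.basic x y h : Γ.R) : Γ.B) ∈ 𝒜

theorem BasicMem.inv {x y : Arr V} (h : BasicMem 𝒜 x y) : BasicMem 𝒜⁻¹ y x := by
  obtain ⟨h, hm⟩ := h
  refine ⟨h.symm, ?_⟩
  rw [← basic_inv h]
  have : (((Γ.basic x y h : Γ.R) : Γ.B)⁻¹)⁻¹ ∈ 𝒜 := by rwa [inv_inv_self]
  exact this

theorem BasicMem.exists_common (h𝒜 : IsUltra 𝒜) {x y x' y' : Arr V} (h : BasicMem 𝒜 x y)
    (h' : BasicMem 𝒜 x' y') : ∃ s s' a b, IsProd x s a ∧ IsProd x' s' a ∧ IsProd y s b ∧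
      IsProd y' s' b := by
  obtain ⟨h, hm⟩ := h
  obtain ⟨h', hm'⟩ := h'
  obtain ⟨c, hc, hc1, hc2⟩ := (filter_iff.1 h𝒜.1.1).2.1 _ hm _ hm'
  obtain ⟨b, a, h1, h2⟩ := R.exists_common (fun h0 => h𝒜.1.2 (h0 ▸ hc)) hc1 hc2
  obtain ⟨s, hs, hs'⟩ := mem_basic.1 h1
  obtain ⟨t, ht, ht'⟩ := mem_basic.1 h2
  exact ⟨s, t, a, b, hs', ht', hs, ht⟩

/-- Below each element of an ultrafilter there are basic morphisms of large degree. -/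
theorem exists_basicMem (hΓ : Γ.NoSources) (h𝒜 : IsUltra 𝒜) {θ : Γ.R} (hθ : (θ : Γ.B) ∈ 𝒜)
    (m : Fin k → ℕ) :
    ∃ x y, x ∈ θ.map y ∧ BasicMem 𝒜 x y ∧ m ≤ Γ.deg x ∧ m ≤ Γ.deg y := by
  obtain ⟨X, hX, hd⟩ := θ.fg_dom
  let Y : Set (Arr V) := ⋃ g ∈ X, {y | ∃ c, IsProd g c y ∧ Γ.deg c = m}
  have hY : Y.Finite := hX.biUnion fun g _ => by
    refine (RowFinite.finite (Γ := Γ) g.right (Γ.deg g + m)).subset ?_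
    rintro y ⟨c, hc, rfl⟩
    exact ⟨hc.right, Γ.deg_prod _ _ _ hc⟩
  -- The classes of the restrictions of θ to the ideals yC with y = gc, g a generator and d(c) = m.
  let T : Set Γ.B := ⋃ y ∈ Y, {q | ∃ x, ∃ h : x.left = y.left, x ∈ θ.map y ∧
    q = ((Γ.basic x y h : Γ.R) : Γ.B)}
  have hT : T.Finite := hY.biUnion fun y _ => Set.Subsingleton.finite (by
    rintro _ ⟨x, h, hx, rfl⟩ _ ⟨x', h', hx', rfl⟩
    obtain rfl := Option.mem_unique hx hx'
    rfl)
  have hTle : ∀ t ∈ T, t ≤ (θ : Γ.B) := by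
    intro t ht
    obtain ⟨y, -, x, h, hx, rfl⟩ := Set.mem_iUnion₂.1 ht
    exact lenz_mk_le (R.basic_le hx h)
  obtain ⟨t, ht, htA⟩ := ultra_exists_mem_of_cover h𝒜 hθ hT hTle fun z hz hzθ => by
    obtain ⟨ψ, hψ, rfl⟩ := lenz_exists_le_mk hzθ
    obtain ⟨b, a, hab⟩ := R.ne_zero_iff.1 (fun h0 : ψ = 0 => hz (by rw [h0]; rfl))
    have hb : b ∈ rightIdeal X := hd ▸ ⟨a, R.le_iff.1 hψ _ _ hab⟩
    obtain ⟨g, hg, s, hs⟩ := hb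
    -- Lengthening b = gs by u of degree m ensures that su has a prefix c of degree m, so bu lies in
    -- gcC and ψ meets the restriction of θ to gcC.
    obtain ⟨u, hu, hud⟩ := hΓ b.left m
    obtain ⟨b', hb'⟩ := IsProd.exists_of_eq b u hu.symm
    obtain ⟨a', ha', hab'⟩ := ψ.isMorphism _ _ _ _ hb' hab
    obtain ⟨w, hw, hw'⟩ := hs.assoc_right hb'
    have hmw : m ≤ Γ.deg w := by
      rw [Γ.deg_prod _ _ _ hw, hud]
      exact le_add_self
    obtain ⟨c, c', hc, hcm⟩ := Γ.exists_prefix_deg hmw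
    obtain ⟨y, hy, hy'⟩ := hc.assoc_left hw'
    obtain ⟨x, hx⟩ : y ∈ pdom θ.map := hd ▸ ⟨g, hg, c, hy⟩
    have hxy := θ.isMorphism.left_eq hx
    obtain ⟨v, hv, hv'⟩ := θ.isMorphism _ _ _ _ hy' hx
    obtain rfl := Option.mem_unique (R.le_iff.1 hψ _ _ hab') hv'
    have hl := ψ.isMorphism.left_eq hab'
    refine ⟨_, Set.mem_biUnion (Set.mem_biUnion hg ⟨c, hy, hcm⟩) ⟨x, hxy, hx, rfl⟩,
      ((Γ.basic a' b' hl : Γ.R) : Γ.B), lenz_mk_ne_zero (R.basic_ne_zero hl),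
      lenz_mk_le (R.basic_le hab' hl), lenz_mk_le (R.basic_le ?_ hl)⟩
    exact mem_basic.2 ⟨c', hy', hv⟩
  obtain ⟨y, hy, x, h, hx, rfl⟩ := Set.mem_iUnion₂.1 ht
  obtain ⟨g, hg, c, hc, rfl⟩ := Set.mem_iUnion₂.1 hy
  obtain ⟨g', hg'⟩ : g ∈ pdom θ.map := hd ▸ subset_rightIdeal X hg
  -- Since θ(gc) = θ(g)c, the value x also has degree at least m.
  obtain ⟨x', hx', hx''⟩ := θ.isMorphism _ _ _ _ hc hg'
  obtain rfl := Option.mem_unique hx hx''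
  refine ⟨x, y, hx, ⟨h, htA⟩, ?_, ?_⟩
  · rw [Γ.deg_prod _ _ _ hx']
    exact le_add_self
  · rw [Γ.deg_prod _ _ _ hc]
    exact le_add_self

theorem exists_basicMem_extend (hΓ : Γ.NoSources) (h𝒜 : IsUltra 𝒜) {x y : Arr V}
    (h : BasicMem 𝒜 x y) (m : Fin k → ℕ) : ∃ s a b, IsProd x s a ∧ IsProd y s b ∧
      BasicMem 𝒜 a b ∧ m ≤ Γ.deg a ∧ m ≤ Γ.deg b := by
  obtain ⟨h, hm⟩ := h
  obtain ⟨a, b, hab, hmem, ha, hb⟩ := exists_basicMem hΓ h𝒜 hm m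
  obtain ⟨s, hs, hs'⟩ := mem_basic.1 hab
  exact ⟨s, a, b, hs', hs, hmem, ha, hb⟩

/-- The good subset of all prefixes of arrows `x` with `[x y⁻¹] ∈ 𝒜` for some `y`. -/
def rangeGood (hΓ : Γ.NoSources) (h𝒜 : IsUltra 𝒜) : Γ.GoodSubset where
  carrier := prefixes {x | ∃ y, BasicMem 𝒜 x y}
  comparable := by
    rintro p ⟨x, ⟨y, hx⟩, u, hu⟩ p' ⟨x', ⟨y', hx'⟩, u', hu'⟩
    obtain ⟨s, s', a, b, hs, hs', -, -⟩ := hx.exists_common h𝒜 hx'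
    obtain ⟨v, -, hv⟩ := hu.assoc_right hs
    obtain ⟨v', -, hv'⟩ := hu'.assoc_right hs'
    exact ⟨v, v', a, hv, hv'⟩
  exists_deg m := by
    obtain ⟨q, hq⟩ := (filter_iff.1 h𝒜.1.1).1
    induction q using Con.induction_on with
    | H θ =>
      obtain ⟨x, y, -, hm, hx, -⟩ := exists_basicMem hΓ h𝒜 hq m
      obtain ⟨p, t, hp, hd⟩ := Γ.exists_prefix_deg hx
      exact ⟨p, ⟨x, ⟨y, hm⟩, t, hp⟩, hd⟩

/-- Lengthen (x, y) to (xs, ys) with xs of degree at least that of xt. Comparability gives xs = xtv,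
so s = tv, and yt is a prefix of ys. -/
theorem BasicMem.leftQuot_subset (hΓ : Γ.NoSources) (h𝒜 : IsUltra 𝒜) {x y : Arr V}
    (h : BasicMem 𝒜 x y) :
    leftQuot x (rangeGood hΓ h𝒜).carrier ⊆ leftQuot y (rangeGood hΓ (ultra_inv h𝒜)).carrier := by
  rintro t ⟨c, hc, ht⟩
  obtain ⟨s, a, b, hsa, hsb, hab, hca, -⟩ := exists_basicMem_extend hΓ h𝒜 h (Γ.deg c)
  obtain ⟨v, hv⟩ := (rangeGood hΓ h𝒜).prefix_of_deg_le hc ⟨a, ⟨b, hab⟩, _, IsProd.id_right a⟩ hca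
  obtain ⟨w, hw, hw'⟩ := ht.assoc_right hv
  obtain rfl := Γ.left_cancel hsa hw'
  obtain ⟨d, hd, hd'⟩ := hw.assoc_left hsb
  exact ⟨d, ⟨b, ⟨a, hab.inv⟩, v, hd'⟩, hd⟩

theorem BasicMem.isWitness (hΓ : Γ.NoSources) (h𝒜 : IsUltra 𝒜) {x y : Arr V}
    (h : BasicMem 𝒜 x y) :
    GoodSubset.IsWitness (rangeGood hΓ h𝒜) (fun i => (Γ.deg x i : ℤ) - (Γ.deg y i : ℤ))
      (rangeGood hΓ (ultra_inv h𝒜)) x y := by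
  refine ⟨⟨x, ⟨y, h⟩, _, IsProd.id_right x⟩, ⟨y, ⟨x, h.inv⟩, _, IsProd.id_right y⟩, h.1,
    fun _ => rfl, Set.Subset.antisymm (h.leftQuot_subset hΓ h𝒜) ?_⟩
  -- The reverse inclusion is the same statement for 𝒜⁻¹, whose inverse is 𝒜.
  have h1 := h.inv.leftQuot_subset hΓ (ultra_inv h𝒜)
  simpa only [set_inv_inv] using h1

/-- Two classes in 𝒜 share a pair (a, b) that lengthens both (x, y) and (x', y'), and lengthening
preserves the difference of degrees. -/
theorem BasicMem.deg_sub_eq (h𝒜 : IsUltra 𝒜) {x y x' y' : Arr V} (h : BasicMem 𝒜 x y)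
    (h' : BasicMem 𝒜 x' y') (i : Fin k) :
    (Γ.deg x i : ℤ) - (Γ.deg y i : ℤ) = (Γ.deg x' i : ℤ) - (Γ.deg y' i : ℤ) := by
  obtain ⟨s, s', a, b, h1, h2, h3, h4⟩ := h.exists_common h𝒜 h'
  have e1 := congrFun (Γ.deg_prod _ _ _ h1) i
  have e2 := congrFun (Γ.deg_prod _ _ _ h2) i
  have e3 := congrFun (Γ.deg_prod _ _ _ h3) i
  have e4 := congrFun (Γ.deg_prod _ _ _ h4) i
  simp only [Pi.add_apply] at *
  omega

open GoodSubset in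
theorem exists_filterOf_eq (hΓ : Γ.NoSources) (h𝒜 : IsUltra 𝒜) :
    ∃ (A : Γ.GoodSubset) (n : Fin k → ℤ) (B : Γ.GoodSubset),
      Allowable A n B ∧ filterOf A n B = 𝒜 := by
  obtain ⟨q, hq⟩ := (filter_iff.1 h𝒜.1.1).1
  induction q using Con.induction_on with
  | H θ =>
    obtain ⟨x, y, -, hxy, -, -⟩ := exists_basicMem hΓ h𝒜 hq 0
    have hw := hxy.isWitness hΓ h𝒜
    refine ⟨_, _, _, hw.allowable,
      (ultra_eq_of_subset h𝒜 (isUltra_filterOf hw.allowable) fun r hr => ?_).symm⟩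
    induction r using Con.induction_on with
    | H φ =>
      obtain ⟨x', y', hm, hxy', -, -⟩ := exists_basicMem hΓ h𝒜 hr 0
      have hw' := hxy'.isWitness hΓ h𝒜
      rw [← funext fun i => hxy.deg_sub_eq h𝒜 hxy' i] at hw'
      exact mk_mem_filterOf.2 ⟨x', y', hm, hw'⟩

open GoodSubset

theorem arrowMap_filterFunctor_bijective (hΓ : Γ.NoSources) :
    Function.Bijective (arrowMap (filterFunctor Γ)) := by
  constructor
  · rintro ⟨B, A, f⟩ ⟨B', A', f'⟩ h
    have h1 : filterOf A f.1 B = filterOf A' f'.1 B' :=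
      congrArg (fun τ : Quiver.Total (IdentityUltrafilter Γ.B) => τ.hom.1) h
    obtain ⟨rfl, h2, rfl⟩ := filterOf_injective f.2 h1
    obtain rfl : f = f' := Subtype.ext h2
    rfl
  · intro τ
    obtain ⟨A, n, B, h, he⟩ := exists_filterOf_eq hΓ τ.hom.2.1
    exact ⟨⟨B, A, ⟨n, h⟩⟩, IdentityUltrafilter.total_ext he⟩

theorem isTopGroupoidIso_filterFunctor (hΓ : Γ.NoSources) :
    IsTopGroupoidIso (filterFunctor Γ) := by
  have hb := arrowMap_filterFunctor_bijective hΓ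
  refine IsHomeomorph.of_generateFrom rfl hb (continuous_generateFrom_iff.2 ?_) ?_
  · rintro _ ⟨s, rfl⟩
    induction s using Con.induction_on with
    | H θ =>
      -- Although θ need not be basic, membership of [θ] is certified by one witness (x, y) with
      -- θ(y) = x, and then holds on all of Z'(x, y).
      refine isOpen_iff_forall_mem_open.2 fun τ hτ => ?_
      obtain ⟨x, y, hx, hw⟩ := mk_mem_filterOf.1 hτ
      refine ⟨Z' x y, fun σ hσ => ?_, isOpen_Z' hw.left_eq, (mem_Z'_iff hw.left_eq).2 hw⟩
      exact mk_mem_filterOf.2 ⟨x, y, hx, (mem_Z'_iff hw.left_eq).1 hσ⟩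
  · rintro _ ⟨x, y, h, rfl⟩
    have h1 : Z' x y = arrowMap (filterFunctor Γ) ⁻¹'
        {τ | ((Γ.basic x y h : Γ.R) : Γ.B) ∈ τ.hom.1} :=
      Set.ext fun τ => mem_Z'_iff_basic_mem h τ
    rw [h1, Set.image_preimage_eq _ hb.2]
    exact TopologicalSpace.isOpen_generateFrom_of_mem ⟨_, rfl⟩

end Ultrafilters

end KGraph

theorem mainTheorem8 {k : ℕ} {V : Type*} [Category V] (Γ : KGraph k V) :
    (∃ F : Γ.Tiling ⥤ Γ.GoodSubset, IsTopGroupoidIso F ∧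
      (∀ w, (F.obj w).carrier = {a | ∃ m : Fin k → ℕ, a = w.seg 0 m zero_le}) ∧
      ∀ (w₁ w₂ : Γ.Tiling) (f : w₂ ⟶ w₁), (F.map f).1 = f.1) ∧
    ∀ [Finite V] [Γ.RowFinite], Γ.NoSources →
      (∃ G : Γ.GoodSubset ⥤ IdentityUltrafilter Γ.B, IsTopGroupoidIso G ∧
        ∀ (x y : Arr V) (h : x.left = y.left) (τ : Quiver.Total Γ.GoodSubset),
          τ ∈ KGraph.GoodSubset.Z' x y ↔
            ((Γ.basic x y h : Γ.R) : Γ.B) ∈ (arrowMap G τ).hom.1) ∧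
      ∃ H : IdentityUltrafilter Γ.B ⥤ Γ.Tiling, IsTopGroupoidIso H := by
  refine ⟨⟨KGraph.Tiling.initialsFunctor Γ, KGraph.Tiling.isTopGroupoidIso_initialsFunctor,
    fun _ => rfl, fun _ _ _ => rfl⟩, fun hΓ => ?_⟩
  have hG := KGraph.isTopGroupoidIso_filterFunctor hΓ
  exact ⟨⟨KGraph.GoodSubset.filterFunctor Γ, hG,
    fun _ _ h => KGraph.GoodSubset.mem_Z'_iff_basic_mem h⟩,
    -- The composite runs from tilings to ultrafilters, so its inverse is taken.
    (hG.comp KGraph.Tiling.isTopGroupoidIso_initialsFunctor).exists_inverse⟩
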